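/- For a complex matrix $M$ write $M^\dagger$ for its conjugate transpose and $M>0$ if it is Hermitian positive definite. Let $$G=U(2,2)=\left\{g=\begin{pmatrix}A&B\\C&D\end{pmatrix}\in GL_4(\mathbb C):\ g^\dagger\gamma^5g=\gamma^5\right\},\qquad \gamma^5=\begin{pmatrix}-I&0\\0&I\end{pmatrix},$$ with $2\times2$ blocks $A,B,C,D$, and let $\mathbb D_4=\{Z\in \mathrm{Mat}_{2\times2}(\mathbb C): I-ZZ^\dagger>0\}$. Let $\lambda\ge 4$ be an integer, and let $$d\nu_\lambda(Z)=c_\lambda\det(I-ZZ^\dagger)^{\lambda-4}\,|dZ|,\qquad c_\lambda=\pi^{-4}(\lambda-1)(\lambda-2)^2(\lambda-3),$$ where $|dZ|$ is Lebesgue measure on $\mathrm{Mat}_{2\times 2}(\mathbb C)\cong\mathbb C^4$. Let $L^2_h(\mathbb D_4,d\nu_\lambda)$ be the space of holomorphic functions on $\mathbb D_4$ that are square integrable for $d\nu_\lambda$, with the scalar product $\langle\phi|\phi'\rangle=\int_{\mathbb D_4}\overline{\phi(Z)}\,\phi'(Z)\,d\nu_\lambda(Z)$. Then: 1. For all $g\in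 G$ and $Z\in\mathbb D_4$ the matrix $D^\dagger-B^\dagger Z$ is invertible and $Z'=(A^\dagger Z-C^\dagger)(D^\dagger-B^\dagger Z)^{-1}$ lies in $\mathbb D_4$. 2. $L^2_h(\mathbb D_4,d\nu_\lambda)$ is a Hilbert space, and it contains the constant function $1$, which has norm $1$. 3. The formula $$[\mathcal U_\lambda(g)\phi](Z)=\det(D^\dagger-B^\dagger Z)^{-\lambda}\,\phi\big((A^\dagger Z-C^\dagger)(D^\dagger-B^\dagger Z)^{-1}\big)$$ defines a unitary representation of $G$ on $L^2_h(\mathbb D_4,d\nu_\lambda)$, that is, a strongly continuous homomorphism from $G$ to the group of unitary operators. It is irreducible (the space is nonzero and its only closed invariant subspaces are zero and the whole space) and square integrable: there is a nonzero $\psi\in L^2_h(\mathbb D_4,d\nu_\lambda)$ with $\int_G|\langle\mathcal U_\lambda(g)\psi|\psi\rangle|^2\,d\mu(g)<\infty$, where $\mu$ is the left-invariant Haar measure of $G$. -/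

import Mathlib

open scoped Matrix ComplexConjugate ComplexOrder

noncomputable section

namespace Conformal

/-! ### Unitary representations on a complex inner product space

A unitary representation is a group homomorphism into the group `H ≃ₗᵢ[ℂ] H` of surjective linear
isometries which is continuous for the strong operator topology. -/

section Representations

variable {G H : Type*} [Group G] [NormedAddCommGroup H] [InnerProductSpace ℂ H]

/-- Continuity of all orbit maps `g ↦ U(g) φ`. -/
def IsStronglyContinuous [TopologicalSpace G] (U : G →* (H ≃ₗᵢ[ℂ] H)) : Prop :=
  ∀ φ : H, Continuous fun g : G => U g φ

/-- Topological irreducibility: the space is nonzero and its only closed invariant linear subspaces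
are zero and the whole space. -/
def IsIrreducible (U : G →* (H ≃ₗᵢ[ℂ] H)) : Prop :=
  Nontrivial H ∧
    ∀ W : Submodule ℂ H, IsClosed (W : Set H) → (∀ g : G, ∀ φ ∈ W, U g φ ∈ W) → W = ⊥ ∨ W = ⊤

/-- A nonzero vector `ψ` is admissible if `∫_G |⟨U(g)ψ | ψ⟩|² dμ(g) < ∞`. -/
def IsAdmissible [MeasurableSpace G] (U : G →* (H ≃ₗᵢ[ℂ] H)) (μ : MeasureTheory.Measure G)
    (ψ : H) : Prop :=
  ψ ≠ 0 ∧ ∫⁻ g, ‖inner ℂ (U g ψ) ψ‖ₑ ^ 2 ∂μ < ⊤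

/-- A representation is square integrable if it has an admissible vector, with respect to the
left-invariant Haar measure of the group. -/
def IsSquareIntegrable [TopologicalSpace G] [IsTopologicalGroup G] [LocallyCompactSpace G]
    [MeasurableSpace G] [BorelSpace G] (U : G →* (H ≃ₗᵢ[ℂ] H)) : Prop :=
  ∃ ψ : H, IsAdmissible U MeasureTheory.Measure.haar ψ

end Representations

/-! ### The group `U(2,2)` -/

/-- The matrix `γ⁵ = diag(-I, I)` in `2 × 2` blocks. -/
def gamma5 : Matrix (Fin 2 ⊕ Fin 2) (Fin 2 ⊕ Fin 2) ℂ := Matrix.fromBlocks (-1) 0 0 1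

/-- The pseudo-unitary group `U(2,2) = {g : g† γ⁵ g = γ⁵}`. -/
def U22 : Subgroup (GL (Fin 2 ⊕ Fin 2) ℂ) where
  carrier := {g | (g : Matrix (Fin 2 ⊕ Fin 2) (Fin 2 ⊕ Fin 2) ℂ)ᴴ * gamma5 * g = gamma5}
  one_mem' := by simp
  mul_mem' := by
    intro a b ha hb
    simp only [Set.mem_ofPred_eq, Units.val_mul, Matrix.conjTranspose_mul] at *
    calc _ = (b : Matrix (Fin 2 ⊕ Fin 2) (Fin 2 ⊕ Fin 2) ℂ)ᴴ
          * ((a : Matrix (Fin 2 ⊕ Fin 2) (Fin 2 ⊕ Fin 2) ℂ)ᴴ * gamma5 * a) * b := by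
            simp only [mul_assoc]
      _ = gamma5 := by rw [ha, hb]
  inv_mem' := by
    intro a ha
    simp only [Set.mem_ofPred_eq] at *
    have h1 : (a : Matrix (Fin 2 ⊕ Fin 2) (Fin 2 ⊕ Fin 2) ℂ)
        * ((a⁻¹ : GL (Fin 2 ⊕ Fin 2) ℂ) : Matrix (Fin 2 ⊕ Fin 2) (Fin 2 ⊕ Fin 2) ℂ) = 1 :=
      Units.mul_inv a
    have h2 := congrArg Matrix.conjTranspose h1
    rw [Matrix.conjTranspose_mul, Matrix.conjTranspose_one] at h2
    conv_lhs => rw [← ha]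
    calc _ = (((a⁻¹ : GL (Fin 2 ⊕ Fin 2) ℂ) : Matrix (Fin 2 ⊕ Fin 2) (Fin 2 ⊕ Fin 2) ℂ)ᴴ
          * (a : Matrix (Fin 2 ⊕ Fin 2) (Fin 2 ⊕ Fin 2) ℂ)ᴴ) * gamma5
          * ((a : Matrix (Fin 2 ⊕ Fin 2) (Fin 2 ⊕ Fin 2) ℂ)
            * ((a⁻¹ : GL (Fin 2 ⊕ Fin 2) ℂ) : Matrix (Fin 2 ⊕ Fin 2) (Fin 2 ⊕ Fin 2) ℂ)) := by
            simp only [mul_assoc]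
      _ = gamma5 := by rw [h1, h2, one_mul, mul_one]

instance : MeasurableSpace U22 := borel U22

instance : BorelSpace U22 := ⟨rfl⟩

/-- The blocks of `g = (A B; C D)`. -/
def blockA (g : U22) : Matrix (Fin 2) (Fin 2) ℂ :=
  (g : GL (Fin 2 ⊕ Fin 2) ℂ).val.toBlocks₁₁

def blockB (g : U22) : Matrix (Fin 2) (Fin 2) ℂ :=
  (g : GL (Fin 2 ⊕ Fin 2) ℂ).val.toBlocks₁₂

def blockC (g : U22) : Matrix (Fin 2) (Fin 2) ℂ :=
  (g : GL (Fin 2 ⊕ Fin 2) ℂ).val.toBlocks₂₁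

def blockD (g : U22) : Matrix (Fin 2) (Fin 2) ℂ :=
  (g : GL (Fin 2 ⊕ Fin 2) ℂ).val.toBlocks₂₂

section LocallyCompact

attribute [local instance] Matrix.linftyOpNormedRing Matrix.linftyOpNormedAlgebra

instance : LocallyCompactSpace U22 := by
  have hGL : LocallyCompactSpace (GL (Fin 2 ⊕ Fin 2) ℂ) := by
    have : ProperSpace (Matrix (Fin 2 ⊕ Fin 2) (Fin 2 ⊕ Fin 2) ℂ) :=
      FiniteDimensional.proper ℂ _
    exact (Units.isOpenEmbedding_val
      (R := Matrix (Fin 2 ⊕ Fin 2) (Fin 2 ⊕ Fin 2) ℂ)).locallyCompactSpace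
  have hc : IsClosed (U22 : Set (GL (Fin 2 ⊕ Fin 2) ℂ)) := by
    change IsClosed {g : GL (Fin 2 ⊕ Fin 2) ℂ |
      (g : Matrix (Fin 2 ⊕ Fin 2) (Fin 2 ⊕ Fin 2) ℂ)ᴴ * gamma5 * g = gamma5}
    refine isClosed_eq ?_ continuous_const
    have hv : Continuous fun g : GL (Fin 2 ⊕ Fin 2) ℂ =>
      (g : Matrix (Fin 2 ⊕ Fin 2) (Fin 2 ⊕ Fin 2) ℂ) := Units.continuous_val
    exact (hv.matrix_conjTranspose.mul continuous_const).mul hv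
  exact hc.isClosedEmbedding_subtypeVal.locallyCompactSpace

end LocallyCompact

/-! ### The Cartan domain and the Bergman measure -/

/-- Lebesgue measure on `Mat_{2×2}(ℂ) = ℂ⁴ = ℝ⁸`. -/
instance : MeasureTheory.MeasureSpace (Matrix (Fin 2) (Fin 2) ℂ) :=
  inferInstanceAs (MeasureTheory.MeasureSpace (Fin 2 → Fin 2 → ℂ))

instance : BorelSpace (Matrix (Fin 2) (Fin 2) ℂ) :=
  inferInstanceAs (BorelSpace (Fin 2 → Fin 2 → ℂ))

theorem isAddHaarMeasure_volume_pi : MeasureTheory.Measure.IsAddHaarMeasure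
    (MeasureTheory.volume : MeasureTheory.Measure (Fin 2 → Fin 2 → ℂ)) := by
  have : MeasureTheory.Measure.IsAddHaarMeasure
      (MeasureTheory.volume : MeasureTheory.Measure (Fin 2 → ℂ)) :=
    MeasureTheory.Measure.pi.isAddHaarMeasure _
  exact MeasureTheory.Measure.pi.isAddHaarMeasure _

instance : MeasureTheory.Measure.IsAddHaarMeasure
    (MeasureTheory.volume : MeasureTheory.Measure (Matrix (Fin 2) (Fin 2) ℂ)) :=
  isAddHaarMeasure_volume_pi

/-- The Cartan domain `D₄ = {Z : I - Z Z† > 0}`. -/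
def cartanDomain : Set (Matrix (Fin 2) (Fin 2) ℂ) := {Z | (1 - Z * Zᴴ).PosDef}

/-- `c_l = π⁻⁴ (l-1)(l-2)²(l-3)`. -/
def normConst (l : ℕ) : ℝ := ((l : ℝ) - 1) * ((l : ℝ) - 2) ^ 2 * ((l : ℝ) - 3) / Real.pi ^ 4

/-- The density `c_l det(I - Z Z†)^{l-4}` (the determinant is real on Hermitian matrices). -/
def density (l : ℕ) (Z : Matrix (Fin 2) (Fin 2) ℂ) : ℝ :=
  normConst l * (1 - Z * Zᴴ).det.re ^ ((l : ℤ) - 4)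

/-- The measure `dν_l(Z) = c_l det(I - Z Z†)^{l-4} |dZ|` on `D₄`. -/
def bergmanMeasure (l : ℕ) : MeasureTheory.Measure (Matrix (Fin 2) (Fin 2) ℂ) :=
  (MeasureTheory.volume.restrict cartanDomain).withDensity
    fun Z => ENNReal.ofReal (density l Z)

/-! ### The space of square integrable holomorphic functions -/

section Bergman

attribute [local instance] Matrix.normedAddCommGroup Matrix.normedSpace

/-- The linear space of functions on `D₄` that are holomorphic and square integrable for `dν_l`. A
function on `D₄` is encoded as a function on all matrices that vanishes outside `D₄`, so that two
elements are equal exactly if they agree on `D₄`. -/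
def holSubmodule (l : ℕ) : Submodule ℂ (Matrix (Fin 2) (Fin 2) ℂ → ℂ) where
  carrier := {φ | DifferentiableOn ℂ φ cartanDomain ∧ (∀ Z ∉ cartanDomain, φ Z = 0) ∧
    MeasureTheory.MemLp φ 2 (bergmanMeasure l)}
  zero_mem' := ⟨differentiableOn_const 0, fun _ _ => rfl, MeasureTheory.MemLp.zero'⟩
  add_mem' := by
    rintro φ φ' ⟨h1, h2, h3⟩ ⟨h1', h2', h3'⟩
    exact ⟨h1.add h1', fun Z hZ => by simp [h2 Z hZ, h2' Z hZ], h3.add h3'⟩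
  smul_mem' := by
    rintro c φ ⟨h1, h2, h3⟩
    exact ⟨h1.const_smul c, fun Z hZ => by simp [h2 Z hZ], h3.const_smul c⟩

/-- The space `L²_h(D₄, dν_l)`. It is a separate type, so that its norm and topology are the ones
of the scalar product below, and not those of pointwise convergence. -/
def HolL2 (l : ℕ) : Type := holSubmodule l

instance (l : ℕ) : AddCommGroup (HolL2 l) := inferInstanceAs (AddCommGroup (holSubmodule l))

instance (l : ℕ) : Module ℂ (HolL2 l) := inferInstanceAs (Module ℂ (holSubmodule l))

instance (l : ℕ) : CoeFun (HolL2 l) fun _ => Matrix (Fin 2) (Fin 2) ℂ → ℂ := ⟨Subtype.val⟩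

/-- The scalar product `⟨φ|φ'⟩ = ∫ conj(φ(Z)) φ'(Z) dν_l(Z)`. -/
def scalarProduct (l : ℕ) (φ φ' : HolL2 l) : ℂ :=
  ∫ Z, conj (φ Z) * φ' Z ∂(bergmanMeasure l)

theorem isOpen_cartanDomain : IsOpen cartanDomain := by
  have hf : Continuous fun p : Matrix (Fin 2) (Fin 2) ℂ × (Fin 2 → ℂ) =>
      (star p.2 ⬝ᵥ ((1 - p.1 * p.1ᴴ) *ᵥ p.2)).re := by
    refine Complex.continuous_re.comp ?_
    refine Continuous.dotProduct continuous_snd.star ?_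
    refine Continuous.matrix_mulVec ?_ continuous_snd
    exact continuous_const.sub (continuous_fst.matrix_mul continuous_fst.matrix_conjTranspose)
  have hH : ∀ Z : Matrix (Fin 2) (Fin 2) ℂ, (1 - Z * Zᴴ).IsHermitian := fun Z =>
    Matrix.isHermitian_one.sub (Matrix.isHermitian_mul_conjTranspose_self Z)
  have key : ∀ Z : Matrix (Fin 2) (Fin 2) ℂ, Z ∈ cartanDomain ↔
      ∀ x ∈ Metric.sphere (0 : Fin 2 → ℂ) 1, 0 < (star x ⬝ᵥ ((1 - Z * Zᴴ) *ᵥ x)).re := by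
    intro Z
    constructor
    · intro hZ x hx
      have hx0 : x ≠ 0 := by
        rintro rfl
        simp at hx
      exact (Matrix.PosDef.re_dotProduct_pos (𝕜 := ℂ) hZ hx0)
    · intro h
      refine Matrix.PosDef.of_dotProduct_mulVec_pos (hH Z) ?_
      intro x hx
      have him : (star x ⬝ᵥ ((1 - Z * Zᴴ) *ᵥ x)).im = 0 :=
        (hH Z).im_star_dotProduct_mulVec_self (𝕜 := ℂ) x
      refine Complex.pos_iff.2 ⟨?_, him.symm⟩
      have hn : 0 < ‖x‖ := norm_pos_iff.2 hx
      have h1 := h (((‖x‖⁻¹ : ℝ) : ℂ) • x) (by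
        simp [norm_smul, hn.ne'])
      rw [Matrix.mulVec_smul, dotProduct_smul, star_smul, smul_dotProduct, smul_eq_mul,
        smul_eq_mul, ← mul_assoc] at h1
      have h2 : ((‖x‖⁻¹ : ℝ) : ℂ) * star ((‖x‖⁻¹ : ℝ) : ℂ) = ((‖x‖⁻¹ * ‖x‖⁻¹ : ℝ) : ℂ) := by
        simp
      rw [h2, Complex.re_ofReal_mul] at h1
      exact (mul_pos_iff_of_pos_left (by positivity)).1 h1
  have hopen : IsOpen {Z : Matrix (Fin 2) (Fin 2) ℂ |
      ∀ x ∈ Metric.sphere (0 : Fin 2 → ℂ) 1, 0 < (star x ⬝ᵥ ((1 - Z * Zᴴ) *ᵥ x)).re} := by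
    rw [isOpen_iff_eventually]
    intro Z hZ
    refine (isCompact_sphere (0 : Fin 2 → ℂ) 1).eventually_forall_of_forall_eventually ?_
    intro x hx
    exact (hf.continuousAt (x := (Z, x))).eventually (lt_mem_nhds (hZ x hx))
  convert hopen using 1
  ext Z
  exact key Z

theorem det_pos_of_mem {Z : Matrix (Fin 2) (Fin 2) ℂ} (hZ : Z ∈ cartanDomain) :
    0 < (1 - Z * Zᴴ).det.re := by
  have h : (1 - Z * Zᴴ).PosDef := hZ
  exact (Complex.pos_iff.1 h.det_pos).1

theorem density_pos (l : ℕ) (hl : 4 ≤ l) {Z : Matrix (Fin 2) (Fin 2) ℂ}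
    (hZ : Z ∈ cartanDomain) : 0 < density l Z := by
  have h4 : (4 : ℝ) ≤ l := by exact_mod_cast hl
  have h1 : (0 : ℝ) < (l : ℝ) - 1 := by linarith
  have h2 : (0 : ℝ) < (l : ℝ) - 2 := by linarith
  have h3 : (0 : ℝ) < (l : ℝ) - 3 := by linarith
  have := det_pos_of_mem hZ
  unfold density normConst
  positivity

theorem integrable_scalarProduct (l : ℕ) (φ φ' : HolL2 l) :
    MeasureTheory.Integrable (fun Z => conj (φ Z) * φ' Z) (bergmanMeasure l) :=
  φ.2.2.2.star.integrable_mul φ'.2.2.2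

theorem scalarProduct_self (l : ℕ) (φ : HolL2 l) :
    scalarProduct l φ φ = ((∫ Z, Complex.normSq (φ Z) ∂(bergmanMeasure l) : ℝ) : ℂ) := by
  unfold scalarProduct
  rw [← integral_complex_ofReal]
  congr 1
  funext Z
  exact (Complex.normSq_eq_conj_mul_self).symm

theorem measurable_density (l : ℕ) : Measurable (density l) := by
  have h : Continuous fun Z : Matrix (Fin 2) (Fin 2) ℂ => (1 - Z * Zᴴ).det.re :=
    Complex.continuous_re.comp (continuous_const.sub
      (continuous_id.matrix_mul continuous_id.matrix_conjTranspose)).matrix_det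
  exact (h.measurable.pow_const _).const_mul _

theorem eq_zero_of_scalarProduct (l : ℕ) (hl : 4 ≤ l) (φ : HolL2 l)
    (h : scalarProduct l φ φ = 0) : φ = 0 := by
  have h0 : ∫ Z, Complex.normSq (φ Z) ∂(bergmanMeasure l) = 0 := by
    rw [scalarProduct_self] at h
    exact_mod_cast h
  have hint : MeasureTheory.Integrable (fun Z => Complex.normSq (φ Z)) (bergmanMeasure l) := by
    refine (integrable_scalarProduct l φ φ).re.congr (Filter.Eventually.of_forall fun Z => ?_)
    change (conj (φ Z) * φ Z).re = _
    rw [← Complex.normSq_eq_conj_mul_self, Complex.ofReal_re]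
  have hae : ∀ᵐ Z ∂(bergmanMeasure l), φ Z = 0 := by
    have := (MeasureTheory.integral_eq_zero_iff_of_nonneg
      (fun Z => Complex.normSq_nonneg (φ Z)) hint).1 h0
    filter_upwards [this] with Z hZ
    exact Complex.normSq_eq_zero.1 hZ
  have hmeas : Measurable fun Z => ENNReal.ofReal (density l Z) := (measurable_density l).ennreal_ofReal
  rw [bergmanMeasure, MeasureTheory.ae_withDensity_iff hmeas] at hae
  have hae' : φ.1 =ᵐ[MeasureTheory.volume.restrict cartanDomain] fun _ => (0 : ℂ) := by
    filter_upwards [hae, MeasureTheory.ae_restrict_mem isOpen_cartanDomain.measurableSet]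
      with Z hZ hmem
    exact hZ (ENNReal.ofReal_pos.2 (density_pos l hl hmem)).ne'
  have heq := MeasureTheory.Measure.eqOn_open_of_ae_eq hae' isOpen_cartanDomain
    φ.2.1.continuousOn continuousOn_const
  apply Subtype.ext
  funext Z
  by_cases hZ : Z ∈ cartanDomain
  · exact heq hZ
  · exact φ.2.2.1 Z hZ

/-- The scalar product is Hermitian and positive definite (for `4 ≤ l`). -/
@[reducible]
def innerCore (l : ℕ) [hl : Fact (4 ≤ l)] : InnerProductSpace.Core ℂ (HolL2 l) where
  inner := scalarProduct l
  conj_inner_symm φ φ' := by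
    unfold scalarProduct
    rw [← integral_conj]
    congr 1
    funext Z
    simp [mul_comm]
  re_inner_nonneg φ := by
    change 0 ≤ (scalarProduct l φ φ).re
    rw [scalarProduct_self, Complex.ofReal_re]
    exact MeasureTheory.integral_nonneg fun Z => Complex.normSq_nonneg _
  add_left φ φ' χ := by
    change scalarProduct l (φ + φ') χ = scalarProduct l φ χ + scalarProduct l φ' χ
    unfold scalarProduct
    rw [← MeasureTheory.integral_add (integrable_scalarProduct l φ χ)
      (integrable_scalarProduct l φ' χ)]
    congr 1
    funext Z
    change conj (φ Z + φ' Z) * χ Z = _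
    rw [map_add, add_mul]
  smul_left φ χ r := by
    change scalarProduct l (r • φ) χ = conj r * scalarProduct l φ χ
    unfold scalarProduct
    rw [← MeasureTheory.integral_const_mul]
    congr 1
    funext Z
    change conj (r * φ Z) * χ Z = _
    rw [map_mul, mul_assoc]
  definite φ h := eq_zero_of_scalarProduct l hl.out φ h

instance (l : ℕ) [Fact (4 ≤ l)] : NormedAddCommGroup (HolL2 l) :=
  (innerCore l).toNormedAddCommGroup

instance (l : ℕ) [Fact (4 ≤ l)] : InnerProductSpace ℂ (HolL2 l) :=
  InnerProductSpace.ofCore (innerCore l).toCore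

end Bergman

/-! ### The action -/

/-- `D† - B† Z`. -/
def denominator (g : U22) (Z : Matrix (Fin 2) (Fin 2) ℂ) : Matrix (Fin 2) (Fin 2) ℂ :=
  (blockD g)ᴴ - (blockB g)ᴴ * Z

/-- `g⁻¹ Z = (A† Z - C†)(D† - B† Z)⁻¹`. -/
def invAction (g : U22) (Z : Matrix (Fin 2) (Fin 2) ℂ) : Matrix (Fin 2) (Fin 2) ℂ :=
  ((blockA g)ᴴ * Z - (blockC g)ᴴ) * (denominator g Z)⁻¹

end Conformal

end

/-!
The proof uses the explicit transitive action of `U(2,2)` on the Cartan domain `D` and the constant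
function `1`, with no general theory of discrete series.

*The action.* Write `Z` in homogeneous coordinates as the `4 × 2` matrix with blocks `Z` and `I`.
Then `g⁻¹` maps it to the homogeneous coordinates of `g⁻¹Z` times `D† - B†Z`, which gives the
cocycle identity, and since `g⁻¹` preserves `γ⁵`,
`(D† - B†Z)† (I - Z'†Z') (D† - B†Z) = I - Z†Z` for `Z' = g⁻¹Z` (`form_denominator_invAction`).
This yields invertibility of the denominator, invariance of `D`, and the transformation law of
`det(I - ZZ†)`. Every point of `D` is the image of `0` under a Hermitian matrix in `U(2,2)`
(`exists_hermitian_boost`).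

*Unitarity.* The derivative of the action has the form `X ↦ P X (D† - B†Z)⁻¹` with
`|det P| |det (D† - B†Z)| = 1`, so its real Jacobian is `|det (D† - B†Z)|⁻⁸`. Together with the
transformation law of the density this is the change of variables `lintegral_invAction`.

*Normalization.* For a fixed first row, `det(I - ZZ†)` is a constant minus a positive definite
Hermitian form in the second row; completing squares reduces the total mass to four integrals over `ℂ`
(`setLIntegral_detOne_pow`).

*Reproducing property and completeness.* The rotations `Z ↦ e^{iθ}Z` preserve the measure, and the
mean value property on the disc `ζ ↦ ζZ` gives `⟨1|φ⟩ = φ(0)` (`inner_oneFun`). Translating by the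
group bounds `|φ(Z)|² det(I - ZZ†)^l` by `‖φ‖²`. Cauchy sequences therefore converge locally
uniformly, the limit is holomorphic by Cauchy estimates, and Fatou's lemma gives convergence in
norm.

*The representation.* A function orthogonal to all `U(g)1` vanishes at every point, so `1` is cyclic.
Since `⟨1|U(g)1⟩ = det(D†)^{-l}` is continuous in `g`, the orbit of `1`, and then every orbit, is
continuous. If `W` is a closed invariant subspace, the projection of `1` to `W` is invariant under
the rotations, hence constant by the mean value property; so `1` lies in `W` or in `Wᗮ`, and
cyclicity gives `W = ⊤` or `W = ⊥`.

*Square integrability.* The integral of `|U(g)1(Z)|²` over `g ∈ G` and over `Z` in a small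
neighbourhood `S` of `0` equals, by the change of variables in `Z`, the measure of the set of pairs
`(g, W)` with `gW ∈ S`. Haar measure is right invariant under the Hermitian elements, because these
are conjugate to their inverses (`map_mul_right_haar`), so this is the Haar measure of
`{g : g0 ∈ S}`, which is relatively compact. By left invariance the same integral is at least
`ν(S) ∫ |⟨U(g)1|1⟩|² dg` (`lintegral_weight_lt_top`).
-/

open scoped Matrix ComplexConjugate ComplexOrder

noncomputable section

namespace Conformal

/-! ### Fractional linear action -/

/-- The space of `2 × 2` complex matrices. -/
abbrev Mat2 : Type := Matrix (Fin 2) (Fin 2) ℂ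

/-- The underlying `4 × 4` matrix of an element of `U(2,2)`. -/
abbrev mat (g : U22) : Matrix (Fin 2 ⊕ Fin 2) (Fin 2 ⊕ Fin 2) ℂ := (g : GL (Fin 2 ⊕ Fin 2) ℂ).val

/-- Homogeneous coordinates of `Z`: the `4 × 2` matrix with upper block `Z` and lower block `1`. -/
def homog (Z : Mat2) : Matrix (Fin 2 ⊕ Fin 2) (Fin 2) ℂ := Matrix.fromRows Z 1

theorem gamma5_mul_self : gamma5 * gamma5 = 1 := by
  simp [gamma5, Matrix.fromBlocks_multiply, Matrix.fromBlocks_one]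

theorem mat_form (g : U22) : (mat g)ᴴ * gamma5 * mat g = gamma5 := g.2

theorem mat_mul (g h : U22) : mat (g * h) = mat g * mat h := rfl

theorem mat_injective : Function.Injective mat := fun _ _ h => Subtype.ext (Units.ext h)

/-- A matrix preserving the form `γ⁵` defines an element of `U(2,2)`; invertibility is automatic. -/
def ofForm (M : Matrix (Fin 2 ⊕ Fin 2) (Fin 2 ⊕ Fin 2) ℂ) (hM : Mᴴ * gamma5 * M = gamma5) : U22 :=
  ⟨⟨M, gamma5 * Mᴴ * gamma5,
    mul_eq_one_comm.1 (by rw [mul_assoc, mul_assoc, ← mul_assoc Mᴴ, hM, gamma5_mul_self]),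
    by rw [mul_assoc, mul_assoc, ← mul_assoc Mᴴ, hM, gamma5_mul_self]⟩, hM⟩

@[simp] theorem mat_ofForm (M : Matrix (Fin 2 ⊕ Fin 2) (Fin 2 ⊕ Fin 2) ℂ)
    (hM : Mᴴ * gamma5 * M = gamma5) : mat (ofForm M hM) = M := rfl

theorem mat_inv (g : U22) : mat g⁻¹ = gamma5 * (mat g)ᴴ * gamma5 := by
  have h1 : mat g⁻¹ * mat g = 1 := by
    rw [← mat_mul, inv_mul_cancel]; rfl
  have h2 : gamma5 * (mat g)ᴴ * gamma5 * mat g = 1 := by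
    rw [mul_assoc, mul_assoc, ← mul_assoc (mat g)ᴴ, mat_form, gamma5_mul_self]
  calc mat g⁻¹ = mat g⁻¹ * (mat g * (gamma5 * (mat g)ᴴ * gamma5)) := by
        rw [mul_eq_one_comm.1 h2, mul_one]
    _ = _ := by rw [← mul_assoc, h1, one_mul]

theorem mat_eq_fromBlocks (g : U22) :
    mat g = Matrix.fromBlocks (blockA g) (blockB g) (blockC g) (blockD g) :=
  (Matrix.fromBlocks_toBlocks _).symm

theorem mat_inv_eq_fromBlocks (g : U22) :
    mat g⁻¹ = Matrix.fromBlocks (blockA g)ᴴ (-(blockC g)ᴴ) (-(blockB g)ᴴ) (blockD g)ᴴ := by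
  rw [mat_inv, mat_eq_fromBlocks, gamma5]
  simp [Matrix.fromBlocks_multiply, Matrix.fromBlocks_conjTranspose]

theorem norm_det_mat (g : U22) : ‖(mat g).det‖ = 1 := by
  have h := congrArg Matrix.det (mat_form g)
  have hg : gamma5.det ≠ 0 := by
    intro h0
    have := congrArg Matrix.det gamma5_mul_self
    simp [h0] at this
  rw [Matrix.det_mul, Matrix.det_mul, Matrix.det_conjTranspose] at h
  have h2 : star (mat g).det * (mat g).det = 1 :=
    mul_left_cancel₀ hg (by rw [mul_one]; linear_combination h)
  have h3 := congrArg norm h2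
  rw [norm_mul, norm_star, norm_one] at h3
  nlinarith [norm_nonneg (mat g).det]

theorem inv_mul_homog (g : U22) (Z : Mat2) :
    mat g⁻¹ * homog Z = Matrix.fromRows ((blockA g)ᴴ * Z - (blockC g)ᴴ) (denominator g Z) := by
  rw [mat_inv_eq_fromBlocks, homog, Matrix.fromBlocks_mul_fromRows, denominator]
  congr 1
  · simp [sub_eq_add_neg]
  · simp [sub_eq_add_neg, add_comm]

theorem conjTranspose_fromRows_form (N M : Mat2) :
    (Matrix.fromRows N M)ᴴ * gamma5 * Matrix.fromRows N M = Mᴴ * M - Nᴴ * N := by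
  rw [Matrix.conjTranspose_fromRows_eq_fromCols_conjTranspose, gamma5, Matrix.mul_assoc,
    Matrix.fromBlocks_mul_fromRows, Matrix.fromCols_mul_fromRows]
  simp [sub_eq_neg_add]

/-- The form `γ⁵` evaluated on the homogeneous coordinates of `Z` is preserved by `g⁻¹`. -/
theorem denominator_form (g : U22) (Z : Mat2) :
    (denominator g Z)ᴴ * denominator g Z -
      ((blockA g)ᴴ * Z - (blockC g)ᴴ)ᴴ * ((blockA g)ᴴ * Z - (blockC g)ᴴ) = 1 - Zᴴ * Z := by
  rw [← conjTranspose_fromRows_form, ← inv_mul_homog, Matrix.conjTranspose_mul]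
  have h1 := conjTranspose_fromRows_form Z 1
  calc _ = (homog Z)ᴴ * ((mat g⁻¹)ᴴ * gamma5 * mat g⁻¹) * homog Z := by
        simp only [Matrix.mul_assoc]
    _ = 1 - Zᴴ * Z := by rw [mat_form, homog, h1]; simp

/-- The inverse of `I - Z†Z` is `I + Z† (I - ZZ†)⁻¹ Z`. -/
theorem posDef_one_sub_conjTranspose_mul {Z : Mat2} (hZ : (1 - Z * Zᴴ).PosDef) :
    (1 - Zᴴ * Z).PosDef := by
  have hu : IsUnit (1 - Z * Zᴴ).det := (Matrix.isUnit_iff_isUnit_det _).1 hZ.isUnit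
  have hpos : (1 + Zᴴ * (1 - Z * Zᴴ)⁻¹ * Z).PosDef :=
    Matrix.PosDef.one.add_posSemidef (hZ.inv.posSemidef.conjTranspose_mul_mul_same Z)
  have hmul : (1 - Zᴴ * Z) * (1 + Zᴴ * (1 - Z * Zᴴ)⁻¹ * Z) = 1 := by
    have h := Matrix.mul_nonsing_inv (1 - Z * Zᴴ) hu
    calc _ = 1 - Zᴴ * Z + Zᴴ * ((1 - Z * Zᴴ) * (1 - Z * Zᴴ)⁻¹) * Z := by noncomm_ring
      _ = 1 := by rw [h]; noncomm_ring
  rw [← Matrix.inv_eq_left_inv hmul]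
  exact hpos.inv

theorem mem_cartanDomain_iff {Z : Mat2} : Z ∈ cartanDomain ↔ (1 - Zᴴ * Z).PosDef := by
  refine ⟨posDef_one_sub_conjTranspose_mul, fun h => ?_⟩
  have := posDef_one_sub_conjTranspose_mul (Z := Zᴴ) (by simpa using h)
  simpa [cartanDomain] using this

theorem isUnit_denominator (g : U22) {Z : Mat2} (hZ : Z ∈ cartanDomain) :
    IsUnit (denominator g Z) := by
  have h1 : ((denominator g Z)ᴴ * denominator g Z).PosDef := by
    rw [← sub_add_cancel ((denominator g Z)ᴴ * denominator g Z)
      (((blockA g)ᴴ * Z - (blockC g)ᴴ)ᴴ * ((blockA g)ᴴ * Z - (blockC g)ᴴ)), denominator_form]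
    exact (mem_cartanDomain_iff.1 hZ).add_posSemidef (Matrix.posSemidef_conjTranspose_mul_self _)
  have h2 := (Matrix.isUnit_iff_isUnit_det _).1 h1.isUnit
  rw [Matrix.det_mul] at h2
  exact (Matrix.isUnit_iff_isUnit_det _).2 (isUnit_of_mul_isUnit_right h2)

theorem det_denominator_ne_zero (g : U22) {Z : Mat2} (hZ : Z ∈ cartanDomain) :
    (denominator g Z).det ≠ 0 :=
  ((Matrix.isUnit_iff_isUnit_det _).1 (isUnit_denominator g hZ)).ne_zero

theorem invAction_mul_denominator (g : U22) {Z : Mat2} (hZ : Z ∈ cartanDomain) :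
    invAction g Z * denominator g Z = (blockA g)ᴴ * Z - (blockC g)ᴴ :=
  Matrix.nonsing_inv_mul_cancel_right _ _
    ((Matrix.isUnit_iff_isUnit_det _).1 (isUnit_denominator g hZ))

theorem form_denominator_invAction (g : U22) {Z : Mat2} (hZ : Z ∈ cartanDomain) :
    (denominator g Z)ᴴ * (1 - (invAction g Z)ᴴ * invAction g Z) * denominator g Z
      = 1 - Zᴴ * Z := by
  rw [← denominator_form g Z, ← invAction_mul_denominator g hZ, Matrix.conjTranspose_mul]
  noncomm_ring

theorem invAction_mem (g : U22) {Z : Mat2} (hZ : Z ∈ cartanDomain) :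
    invAction g Z ∈ cartanDomain := by
  rw [mem_cartanDomain_iff, ← Matrix.IsUnit.posDef_star_left_conjugate_iff
    (isUnit_denominator g hZ), Matrix.star_eq_conjTranspose, form_denominator_invAction g hZ]
  exact mem_cartanDomain_iff.1 hZ

/-- Fractional linear transformations are matrix multiplication in homogeneous coordinates. -/
theorem inv_mul_homog_eq (g : U22) {Z : Mat2} (hZ : Z ∈ cartanDomain) :
    mat g⁻¹ * homog Z = homog (invAction g Z) * denominator g Z := by
  rw [inv_mul_homog, homog, Matrix.fromRows_mul, invAction_mul_denominator g hZ, one_mul]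

/-- The homogeneous coordinates of `(gh)⁻¹ Z`, computed in two ways. -/
theorem cocycle (g h : U22) {Z : Mat2} (hZ : Z ∈ cartanDomain) :
    denominator (g * h) Z = denominator h (invAction g Z) * denominator g Z ∧
      invAction (g * h) Z = invAction h (invAction g Z) := by
  have h1 : homog (invAction (g * h) Z) * denominator (g * h) Z =
      homog (invAction h (invAction g Z)) *
        (denominator h (invAction g Z) * denominator g Z) := by
    rw [← inv_mul_homog_eq _ hZ, mul_inv_rev, mat_mul, Matrix.mul_assoc, inv_mul_homog_eq g hZ,
      ← Matrix.mul_assoc, inv_mul_homog_eq h (invAction_mem g hZ), Matrix.mul_assoc]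
  rw [homog, homog, Matrix.fromRows_mul, Matrix.fromRows_mul] at h1
  obtain ⟨h2, h3⟩ := Matrix.fromRows_inj h1
  rw [one_mul, one_mul] at h3
  refine ⟨h3, ?_⟩
  rw [← h3] at h2
  exact (isUnit_denominator _ hZ).mul_right_cancel h2

theorem denominator_mul (g h : U22) {Z : Mat2} (hZ : Z ∈ cartanDomain) :
    denominator (g * h) Z = denominator h (invAction g Z) * denominator g Z := (cocycle g h hZ).1

theorem invAction_mul (g h : U22) {Z : Mat2} (hZ : Z ∈ cartanDomain) :
    invAction (g * h) Z = invAction h (invAction g Z) := (cocycle g h hZ).2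

theorem blocks_one : blockA 1 = 1 ∧ blockB 1 = 0 ∧ blockC 1 = 0 ∧ blockD 1 = 1 := by
  have h := mat_eq_fromBlocks 1
  have h1 : mat 1 = Matrix.fromBlocks 1 0 0 1 := Matrix.fromBlocks_one.symm
  rw [h1, Matrix.fromBlocks_inj] at h
  exact ⟨h.1.symm, h.2.1.symm, h.2.2.1.symm, h.2.2.2.symm⟩

@[simp] theorem denominator_one (Z : Mat2) : denominator 1 Z = 1 := by
  simp [denominator, blocks_one]

@[simp] theorem invAction_one (Z : Mat2) : invAction 1 Z = Z := by
  simp [invAction, blocks_one]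

theorem invAction_inv_invAction (g : U22) {Z : Mat2} (hZ : Z ∈ cartanDomain) :
    invAction g⁻¹ (invAction g Z) = Z := by
  rw [← invAction_mul g g⁻¹ hZ, mul_inv_cancel, invAction_one]

theorem invAction_invAction_inv (g : U22) {Z : Mat2} (hZ : Z ∈ cartanDomain) :
    invAction g (invAction g⁻¹ Z) = Z := by
  simpa using invAction_inv_invAction g⁻¹ hZ

/-- The function `det(I - Z Z†)`, encoded as the real part of the determinant, which is real. -/
def detOne (Z : Mat2) : ℝ := (1 - Z * Zᴴ).det.re

theorem detOne_pos {Z : Mat2} (hZ : Z ∈ cartanDomain) : 0 < detOne Z := det_pos_of_mem hZ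

theorem ofReal_detOne (Z : Mat2) : ((detOne Z : ℝ) : ℂ) = (1 - Z * Zᴴ).det := by
  have h : (1 - Z * Zᴴ).IsHermitian :=
    Matrix.isHermitian_one.sub (Matrix.isHermitian_mul_conjTranspose_self Z)
  have h2 : conj (1 - Z * Zᴴ).det = (1 - Z * Zᴴ).det := by
    conv_rhs => rw [← h.eq, Matrix.det_conjTranspose]
    rfl
  exact Complex.conj_eq_iff_re.1 h2

theorem detOne_invAction (g : U22) {Z : Mat2} (hZ : Z ∈ cartanDomain) :
    detOne (invAction g Z) * ‖(denominator g Z).det‖ ^ 2 = detOne Z := by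
  have h := congrArg Matrix.det (form_denominator_invAction g hZ)
  rw [Matrix.det_mul, Matrix.det_mul, Matrix.det_conjTranspose, Matrix.det_one_sub_mul_comm,
    Matrix.det_one_sub_mul_comm Zᴴ, ← ofReal_detOne, ← ofReal_detOne] at h
  have h2 : star (denominator g Z).det * (denominator g Z).det =
      ((‖(denominator g Z).det‖ ^ 2 : ℝ) : ℂ) := by
    rw [Complex.star_def, Complex.conj_mul']; norm_cast
  have h3 : ((detOne (invAction g Z) * ‖(denominator g Z).det‖ ^ 2 : ℝ) : ℂ) = detOne Z := by
    rw [← h, Complex.ofReal_mul, ← h2]; ring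
  exact_mod_cast h3

theorem zero_mem_cartanDomain : (0 : Mat2) ∈ cartanDomain := by
  simpa [cartanDomain] using Matrix.PosDef.one (n := Fin 2) (R := ℂ)

@[simp] theorem detOne_zero : detOne 0 = 1 := by simp [detOne]

theorem denominator_zero (g : U22) : denominator g 0 = (blockD g)ᴴ := by simp [denominator]

/-! ### Hermitian boosts -/

/-- The element `γ⁵` of `U(2,2)`. -/
def gammaElt : U22 := ofForm gamma5 (by
  have : gamma5ᴴ = gamma5 := by simp [gamma5, Matrix.fromBlocks_conjTranspose]
  rw [this, gamma5_mul_self, one_mul])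

/-- Hermitian elements are conjugate to their inverses, since `g⁻¹ = γ⁵ g† γ⁵`. -/
theorem gammaElt_conj {h : U22} (hh : (mat h).IsHermitian) : gammaElt * h * gammaElt⁻¹ = h⁻¹ := by
  have h1 : gammaElt⁻¹ = gammaElt :=
    inv_eq_of_mul_eq_one_right (mat_injective (by
      rw [mat_mul, gammaElt, mat_ofForm, gamma5_mul_self]; rfl))
  apply mat_injective
  rw [h1, mat_inv, hh.eq]
  rfl

/-- The Cayley–Hamilton theorem for `2 × 2` matrices. -/
theorem mul_self_fin_two (M : Mat2) : M * M = M.trace • M - M.det • 1 := by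
  ext i j
  fin_cases i <;> fin_cases j <;>
    simp [Matrix.mul_apply, Fin.sum_univ_two, Matrix.trace_fin_two, Matrix.det_fin_two] <;> ring

/-- Every point of the domain is the image of `0` under a Hermitian element of `U(2,2)`. By the
Cayley–Hamilton theorem the inverse square roots of `I - ZZ†` and `I - Z†Z` are affine functions of
these matrices with the same real coefficients, since the two have equal trace and determinant. -/
theorem exists_hermitian_boost {Z : Mat2} (hZ : Z ∈ cartanDomain) :
    ∃ h : U22, (mat h).IsHermitian ∧ invAction h⁻¹ 0 = Z := by
  set M : Mat2 := 1 - Z * Zᴴ with hM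
  set N : Mat2 := 1 - Zᴴ * Z with hN
  have hMp : M.PosDef := hZ
  have hNM : N.det = M.det := (Matrix.det_one_sub_mul_comm _ _)
  have hNMt : N.trace = M.trace := by simp [hM, hN, Matrix.trace_mul_comm Z]
  have hNZ : N * Zᴴ = Zᴴ * M := by rw [hM, hN]; noncomm_ring
  obtain ⟨d, hd, hdM⟩ : ∃ d : ℝ, 0 < d ∧ M.det = d :=
    ⟨detOne Z, detOne_pos hZ, (ofReal_detOne Z).symm⟩
  obtain ⟨t, ht, htM⟩ : ∃ t : ℝ, 0 < t ∧ M.trace = t := by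
    have := Complex.pos_iff.1 hMp.trace_pos
    exact ⟨M.trace.re, this.1, Complex.ext (by simp) (by simp [← this.2])⟩
  obtain ⟨s, hs, hsd⟩ : ∃ s : ℝ, 0 < s ∧ s ^ 2 = d := ⟨√d, Real.sqrt_pos.2 hd, Real.sq_sqrt hd.le⟩
  obtain ⟨τ, hτ, hτt⟩ : ∃ τ : ℝ, 0 < τ ∧ τ ^ 2 = t + 2 * s :=
    ⟨√(t + 2 * s), Real.sqrt_pos.2 (by positivity), Real.sq_sqrt (by positivity)⟩
  -- `(M + s) / τ` is the square root of `M`, and `(t + s - M) / (τ s)` is its inverse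
  set c : ℂ := ((τ * s : ℝ) : ℂ)⁻¹ with hc
  have hτs : ((τ * s : ℝ) : ℂ) ≠ 0 := by exact_mod_cast (mul_pos hτ hs).ne'
  have hc2 : c * c * ((t + 2 * s) * d) = 1 := by
    have h1 : (((t + 2 * s) * d : ℝ) : ℂ) = ((τ * s : ℝ) : ℂ) * ((τ * s : ℝ) : ℂ) := by
      rw [← hτt, ← hsd]; push_cast; ring
    push_cast at h1
    rw [h1, hc]
    push_cast at hτs ⊢
    field_simp
  set S : Mat2 := c • (((t + s : ℝ) : ℂ) • 1 - M) with hS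
  set T : Mat2 := c • (((t + s : ℝ) : ℂ) • 1 - N) with hT
  have hcs : star c = c := by simp [hc]
  have hsqrt : ∀ P : Mat2, P.trace = t → P.det = d →
      (c • (((t + s : ℝ) : ℂ) • 1 - P)) * P * (c • (((t + s : ℝ) : ℂ) • 1 - P)) = 1 := by
    intro P h1 h2
    have hP := mul_self_fin_two P
    rw [h1, h2] at hP
    have hd2 : (d : ℂ) = s * s := by rw [← hsd]; push_cast; ring
    have hPP : P * P * P = (t : ℂ) • (P * P) - (d : ℂ) • P := by
      rw [hP, sub_mul, smul_mul_assoc, smul_mul_assoc, one_mul, hP]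
    have : (c • (((t + s : ℝ) : ℂ) • 1 - P)) * P * (c • (((t + s : ℝ) : ℂ) • 1 - P)) =
        (c * c) • (((t + s : ℂ) ^ 2) • P - (2 * (t + s : ℂ)) • (P * P) + P * P * P) := by
      simp only [smul_mul_assoc, mul_smul_comm, smul_smul, sub_mul, mul_sub, one_mul, mul_one,
        smul_sub, smul_add]
      push_cast
      module
    rw [this, hPP, hP]
    have : ((t + s : ℂ) ^ 2) • P - (2 * (t + s : ℂ)) • ((t : ℂ) • P - (d : ℂ) • (1 : Mat2)) +
        ((t : ℂ) • ((t : ℂ) • P - (d : ℂ) • (1 : Mat2)) - (d : ℂ) • P) =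
        (((t : ℂ) + 2 * s) * d) • (1 : Mat2) := by
      rw [hd2]; module
    rw [this, smul_smul, hc2, one_smul]
  have hSM : S * M * S = 1 := hsqrt M htM hdM
  have hTN : T * N * T = 1 := hsqrt N (hNMt.trans htM) (hNM.trans hdM)
  have hherm : ∀ P : Mat2, Pᴴ = P → (c • (((t + s : ℝ) : ℂ) • 1 - P))ᴴ =
      c • (((t + s : ℝ) : ℂ) • 1 - P) := by
    intro P h
    rw [Matrix.conjTranspose_smul, hcs, Matrix.conjTranspose_sub, Matrix.conjTranspose_smul, h]
    simp
  have hSh : Sᴴ = S := hherm M hMp.isHermitian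
  have hTh : Tᴴ = T := hherm N (by simp [hN])
  have hTZ : T * Zᴴ = Zᴴ * S := by
    rw [hT, hS, smul_mul_assoc, mul_smul_comm, sub_mul, mul_sub, hNZ]; simp
  have hform : (Matrix.fromBlocks S (Z * T) (Zᴴ * S) T)ᴴ * gamma5 *
      Matrix.fromBlocks S (Z * T) (Zᴴ * S) T = gamma5 := by
    rw [Matrix.fromBlocks_conjTranspose, gamma5, Matrix.fromBlocks_multiply,
      Matrix.fromBlocks_multiply]
    simp only [Matrix.conjTranspose_mul, hSh, hTh, Matrix.conjTranspose_conjTranspose]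
    have e1 : S * S - S * Z * (Zᴴ * S) = 1 := by rw [← hSM, hM]; noncomm_ring
    have e2 : T * T - T * Zᴴ * (Z * T) = 1 := by rw [← hTN, hN]; noncomm_ring
    congr 1
    · refine Eq.trans ?_ (congrArg Neg.neg e1)
      noncomm_ring
    · noncomm_ring
    · noncomm_ring
    · refine Eq.trans ?_ e2
      noncomm_ring
  -- `S` and `T` are the inverse square roots of `I - ZZ†` and `I - Z†Z`
  obtain ⟨h, hh⟩ : ∃ h : U22, mat h = Matrix.fromBlocks S (Z * T) (Zᴴ * S) T :=
    ⟨ofForm _ hform, mat_ofForm _ _⟩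
  refine ⟨h, ?_, ?_⟩
  · rw [hh, Matrix.IsHermitian, Matrix.fromBlocks_conjTranspose, hSh, hTh,
      Matrix.conjTranspose_mul, Matrix.conjTranspose_mul, hSh, hTh, hTZ,
      Matrix.conjTranspose_conjTranspose]
    congr 1
    simpa [Matrix.conjTranspose_mul, hSh, hTh] using (congrArg Matrix.conjTranspose hTZ).symm
  · have h1 := inv_mul_homog_eq h⁻¹ zero_mem_cartanDomain
    rw [inv_inv, hh, homog, homog, Matrix.fromBlocks_mul_fromRows, Matrix.fromRows_mul] at h1
    obtain ⟨h2, h3⟩ := Matrix.fromRows_inj h1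
    simp only [mul_zero, zero_add, mul_one, one_mul] at h2 h3
    rw [h3] at h2
    exact ((isUnit_denominator _ zero_mem_cartanDomain).mul_right_cancel h2).symm

/-! ### The Jacobian of the action -/

/-- The linear map `X ↦ P X Q` on matrices. -/
def sandwich (P Q : Mat2) : Mat2 →ₗ[ℂ] Mat2 := LinearMap.mulLeft ℂ P ∘ₗ LinearMap.mulRight ℂ Q

@[simp] theorem sandwich_apply (P Q X : Mat2) : sandwich P Q X = P * (X * Q) := rfl

/-- Under vectorization `X ↦ P X Q` is the Kronecker product of `Qᵀ` and `P`. -/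
theorem det_sandwich (P Q : Mat2) : LinearMap.det (sandwich P Q) = P.det ^ 2 * Q.det ^ 2 := by
  let e : Mat2 ≃ₗ[ℂ] (Fin 2 × Fin 2 → ℂ) := LinearEquiv.ofBijective
    { toFun := Matrix.vec, map_add' := Matrix.vec_add, map_smul' := Matrix.vec_smul }
    Matrix.vec_bijective
  have he : ∀ X, e X = Matrix.vec X := fun _ => rfl
  have h : (e : Mat2 →ₗ[ℂ] _) ∘ₗ sandwich P Q ∘ₗ (e.symm : _ →ₗ[ℂ] Mat2) =
      Matrix.toLin' (Matrix.kroneckerMap (· * ·) Qᵀ P) := by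
    apply LinearMap.ext
    intro x
    obtain ⟨X, rfl⟩ := e.surjective x
    rw [LinearMap.comp_apply, LinearMap.comp_apply, LinearEquiv.coe_coe, LinearEquiv.coe_coe,
      LinearEquiv.symm_apply_apply, Matrix.toLin'_apply, he, he, sandwich_apply]
    rw [Matrix.kronecker_mulVec_vec, Matrix.transpose_transpose, Matrix.mul_assoc]
  rw [← LinearMap.det_conj _ e, h, LinearMap.det_toLin', Matrix.det_kronecker]
  simp [mul_comm]

/-- The real determinant is the squared modulus of the complex one. -/
theorem det_restrictScalars_sandwich (P Q : Mat2) :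
    LinearMap.det ((sandwich P Q).restrictScalars ℝ) = (‖P.det‖ * ‖Q.det‖) ^ 4 := by
  rw [LinearMap.det_restrictScalars, det_sandwich, Algebra.norm_complex_eq]
  simp [Complex.normSq_eq_norm_sq]
  ring

/-- Left factor of the derivative `X ↦ P X (D† - B†Z)⁻¹` of the action at `Z`. -/
def jacobianLeft (g : U22) (Z : Mat2) : Mat2 := (blockA g)ᴴ + invAction g Z * (blockB g)ᴴ

/-- Multiplying `g⁻¹` by unipotent matrices on both sides makes it block triangular, with diagonal
blocks the left factor of the derivative and the denominator. -/
theorem norm_det_jacobianLeft (g : U22) {Z : Mat2} (hZ : Z ∈ cartanDomain) :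
    ‖(jacobianLeft g Z).det‖ * ‖(denominator g Z).det‖ = 1 := by
  have h : Matrix.fromBlocks 1 (-invAction g Z) 0 1 * mat g⁻¹ * Matrix.fromBlocks 1 Z 0 1 =
      Matrix.fromBlocks (jacobianLeft g Z) 0 (-(blockB g)ᴴ) (denominator g Z) := by
    rw [mat_inv_eq_fromBlocks, Matrix.fromBlocks_multiply, Matrix.fromBlocks_multiply]
    congr 1
    · simp [jacobianLeft]
    · have h1 := invAction_mul_denominator g hZ
      rw [denominator] at h1
      refine Eq.trans ?_ (sub_eq_zero.2 h1.symm)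
      noncomm_ring
    · simp
    · simp [denominator]; abel
  have h2 := congrArg (fun M => ‖Matrix.det M‖) h
  simpa [Matrix.det_mul, Matrix.det_fromBlocks_zero₂₁, Matrix.det_fromBlocks_zero₁₂,
    norm_det_mat] using h2.symm

section Derivative

attribute [local instance] Matrix.linftyOpNormedRing Matrix.linftyOpNormedAlgebra

theorem hasFDerivAt_invAction (g : U22) {Z : Mat2} (hZ : Z ∈ cartanDomain) :
    HasFDerivAt (𝕜 := ℂ) (invAction g)
      (sandwich (jacobianLeft g Z) (denominator g Z)⁻¹).toContinuousLinearMap Z := by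
  obtain ⟨u, hu⟩ := isUnit_denominator g hZ
  have hN : HasFDerivAt (𝕜 := ℂ) (fun W : Mat2 => (blockA g)ᴴ * W - (blockC g)ᴴ)
      (ContinuousLinearMap.mul ℂ Mat2 (blockA g)ᴴ) Z :=
    (ContinuousLinearMap.mul ℂ Mat2 (blockA g)ᴴ).hasFDerivAt.sub_const _
  have hM : HasFDerivAt (𝕜 := ℂ) (denominator g)
      (-(ContinuousLinearMap.mul ℂ Mat2 (blockB g)ᴴ)) Z :=
    (ContinuousLinearMap.mul ℂ Mat2 (blockB g)ᴴ).hasFDerivAt.const_sub _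
  have hI : HasFDerivAt (𝕜 := ℂ) (Ring.inverse : Mat2 → Mat2) _ (denominator g Z) :=
    hu ▸ hasFDerivAt_ringInverse (𝕜 := ℂ) u
  have h := hN.mul' (hI.comp Z hM)
  have hfun : invAction g = (fun W : Mat2 => (blockA g)ᴴ * W - (blockC g)ᴴ) *
      (Ring.inverse ∘ denominator g) := by
    funext W
    simp [invAction, Matrix.nonsing_inv_eq_ringInverse]
  rw [hfun]
  refine h.congr_fderiv ?_
  have hinv : (denominator g Z)⁻¹ = ((u⁻¹ : Mat2ˣ) : Mat2) := by
    rw [← hu, Matrix.coe_units_inv]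
  apply ContinuousLinearMap.ext
  intro X
  have hR : Ring.inverse (denominator g Z) = (denominator g Z)⁻¹ :=
    (Matrix.nonsing_inv_eq_ringInverse _).symm
  have hS : ∀ P Q : Mat2, (sandwich P Q).toContinuousLinearMap X = P * (X * Q) := fun _ _ => rfl
  refine Eq.trans ?_ (hS _ _).symm
  simp only [add_apply, smul_apply,
    ContinuousLinearMap.comp_apply, neg_apply, Function.comp_apply,
    ContinuousLinearMap.mul_apply', smul_eq_mul, hR, ContinuousLinearMap.mulLeftRight_apply,
    jacobianLeft, invAction,
    MulOpposite.smul_eq_mul_unop, MulOpposite.unop_op, ← hinv]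
  noncomm_ring

end Derivative

/-! ### Change of variables in the Bergman measure -/

section Bergman

attribute [local instance] Matrix.normedAddCommGroup Matrix.normedSpace

open MeasureTheory

theorem differentiableOn_invAction (g : U22) :
    DifferentiableOn ℂ (invAction g) cartanDomain := fun _ hZ =>
  ⟨_, (hasFDerivAt_invAction g hZ).hasFDerivWithinAt⟩

theorem image_invAction (g : U22) : invAction g '' cartanDomain = cartanDomain := by
  refine Set.Subset.antisymm (Set.image_subset_iff.2 fun Z hZ => invAction_mem g hZ) fun Z hZ => ?_
  exact ⟨invAction g⁻¹ Z, invAction_mem g⁻¹ hZ, invAction_invAction_inv g hZ⟩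

theorem injOn_invAction (g : U22) : Set.InjOn (invAction g) cartanDomain := fun _ hZ _ hW h => by
  rw [← invAction_inv_invAction g hZ, h, invAction_inv_invAction g hW]

/-- The real Jacobian of `Z ↦ g⁻¹ Z` is `|det (D† - B†Z)|⁻⁸`. -/
theorem setLIntegral_invAction (g : U22) (F : Mat2 → ENNReal) :
    ∫⁻ Z in cartanDomain, F Z =
      ∫⁻ Z in cartanDomain, ENNReal.ofReal (‖(denominator g Z).det‖ ^ 8)⁻¹ * F (invAction g Z) := by
  have hd : ∀ Z ∈ cartanDomain, HasFDerivWithinAt (𝕜 := ℝ) (invAction g)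
      ((sandwich (jacobianLeft g Z) (denominator g Z)⁻¹).toContinuousLinearMap.restrictScalars ℝ)
      cartanDomain Z := fun Z hZ =>
    (HasFDerivAt.restrictScalars ℝ (hasFDerivAt_invAction g hZ)).hasFDerivWithinAt
  -- the norm topology is the product topology, but only up to unfolding
  have : @BorelSpace Mat2
      Matrix.normedAddCommGroup.toPseudoMetricSpace.toUniformSpace.toTopologicalSpace _ :=
    inferInstanceAs (BorelSpace (Fin 2 → Fin 2 → ℂ))
  have : @Measure.IsAddHaarMeasure Mat2 Matrix.normedAddCommGroup.toAddCommGroup.toAddGroup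
      Matrix.normedAddCommGroup.toPseudoMetricSpace.toUniformSpace.toTopologicalSpace _ volume :=
    isAddHaarMeasure_volume_pi
  have h := lintegral_image_eq_lintegral_abs_det_fderiv_mul (volume : Measure Mat2)
    isOpen_cartanDomain.measurableSet hd (injOn_invAction g) F
  rw [image_invAction] at h
  rw [h]
  refine setLIntegral_congr_fun isOpen_cartanDomain.measurableSet fun Z hZ => ?_
  have h1 := norm_det_jacobianLeft g hZ
  have h2 : ‖(denominator g Z).det‖ ≠ 0 := norm_ne_zero_iff.2 (det_denominator_ne_zero g hZ)
  have hdet : ((sandwich (jacobianLeft g Z)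
      (denominator g Z)⁻¹).toContinuousLinearMap.restrictScalars ℝ).det =
      (‖(denominator g Z).det‖ ^ 8)⁻¹ := by
    refine (det_restrictScalars_sandwich _ _).trans ?_
    rw [Matrix.det_nonsing_inv, Ring.inverse_eq_inv', norm_inv, eq_inv_of_mul_eq_one_left h1]
    field_simp
  simp only [hdet]
  rw [abs_of_nonneg (by positivity)]

theorem lintegral_bergmanMeasure (l : ℕ) (F : Mat2 → ENNReal) :
    ∫⁻ Z, F Z ∂(bergmanMeasure l) = ∫⁻ Z in cartanDomain, ENNReal.ofReal (density l Z) * F Z := by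
  rw [bergmanMeasure, lintegral_withDensity_eq_lintegral_mul_non_measurable _
    (measurable_density l).ennreal_ofReal
    (Filter.Eventually.of_forall fun _ => ENNReal.ofReal_lt_top)]
  rfl

theorem ae_mem_cartanDomain (l : ℕ) : ∀ᵐ Z ∂(bergmanMeasure l), Z ∈ cartanDomain :=
  (withDensity_absolutelyContinuous _ _).ae_le
    (ae_restrict_mem isOpen_cartanDomain.measurableSet)

theorem density_eq (l : ℕ) (Z : Mat2) : density l Z = normConst l * detOne Z ^ ((l : ℤ) - 4) := rfl

/-- The change of variables `Z ↦ g⁻¹ Z` in the Bergman measure: the automorphy factor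
`|det (D† - B† Z)|^{-2l}` is the density of the transported measure. -/
theorem lintegral_invAction (l : ℕ) (g : U22) (F : Mat2 → ENNReal) :
    ∫⁻ Z, ‖(denominator g Z).det ^ (-(l : ℤ))‖ₑ ^ 2 * F (invAction g Z) ∂(bergmanMeasure l) =
      ∫⁻ Z, F Z ∂(bergmanMeasure l) := by
  rw [lintegral_bergmanMeasure, lintegral_bergmanMeasure,
    setLIntegral_invAction g fun Z => ENNReal.ofReal (density l Z) * F Z]
  refine setLIntegral_congr_fun isOpen_cartanDomain.measurableSet fun Z hZ => ?_
  simp only [← mul_assoc]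
  congr 1
  have h2 : 0 < ‖(denominator g Z).det‖ := norm_pos_iff.2 (det_denominator_ne_zero g hZ)
  rw [← ofReal_norm, ← ENNReal.ofReal_pow (norm_nonneg _),
    ← ENNReal.ofReal_mul' (pow_nonneg (norm_nonneg _) 2),
    ← ENNReal.ofReal_mul (inv_nonneg.2 (pow_nonneg (norm_nonneg _) 8)),
    density_eq, density_eq, ← detOne_invAction g hZ, norm_zpow, mul_zpow]
  congr 1
  rw [← zpow_natCast _ 8, ← zpow_natCast _ 2, ← zpow_natCast _ 2, ← zpow_mul, ← zpow_mul,
    ← zpow_neg]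
  have h3 : ‖(denominator g Z).det‖ ^ (-((8 : ℕ) : ℤ)) =
      ‖(denominator g Z).det‖ ^ (((2 : ℕ) : ℤ) * ((l : ℤ) - 4)) *
        ‖(denominator g Z).det‖ ^ (-(l : ℤ) * ((2 : ℕ) : ℤ)) := by
    rw [← zpow_add₀ h2.ne']
    congr 1
    push_cast
    ring
  rw [h3]
  ring

/-! ### The representation -/

theorem HolL2.ext {l : ℕ} {φ ψ : HolL2 l} (h : ∀ Z ∈ cartanDomain, φ Z = ψ Z) : φ = ψ := by
  apply Subtype.ext
  funext Z
  by_cases hZ : Z ∈ cartanDomain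
  · exact h Z hZ
  · exact (φ.2.2.1 Z hZ).trans (ψ.2.2.1 Z hZ).symm

theorem measurable_of_differentiableOn {f : Mat2 → ℂ} (hf : DifferentiableOn ℂ f cartanDomain)
    (h0 : ∀ Z ∉ cartanDomain, f Z = 0) : Measurable f := by
  classical
  have h := hf.continuousOn.measurable_piecewise (g := fun _ => (0 : ℂ)) continuousOn_const
    isOpen_cartanDomain.measurableSet
  convert h using 1
  funext Z
  by_cases hZ : Z ∈ cartanDomain
  · simp [hZ]
  · simp [hZ, h0 Z hZ]

theorem HolL2.measurable {l : ℕ} (φ : HolL2 l) : Measurable φ :=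
  measurable_of_differentiableOn φ.2.1 φ.2.2.1

theorem eLpNorm_two_sq {α : Type*} [MeasurableSpace α] (μ : Measure α) (f : α → ℂ) :
    eLpNorm f 2 μ ^ 2 = ∫⁻ Z, ‖f Z‖ₑ ^ 2 ∂μ := by
  rw [eLpNorm_eq_lintegral_rpow_enorm_toReal (by simp) (by simp)]
  simp only [ENNReal.toReal_ofNat, one_div, ENNReal.rpow_ofNat]
  rw [← ENNReal.rpow_natCast, ← ENNReal.rpow_mul]
  simp

/-- A function holomorphic on the domain with finite `L²` integral, as an element of `HolL2`: it is
set to `0` outside the domain. -/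
def HolL2.mk {l : ℕ} (f : Mat2 → ℂ) (hf : DifferentiableOn ℂ f cartanDomain)
    (hi : ∫⁻ Z, ‖f Z‖ₑ ^ 2 ∂(bergmanMeasure l) < ⊤) : HolL2 l :=
  ⟨cartanDomain.indicator f, by
    have hd : DifferentiableOn ℂ (cartanDomain.indicator f) cartanDomain :=
      hf.congr fun Z hZ => Set.indicator_of_mem hZ f
    have h0 : ∀ Z ∉ cartanDomain, cartanDomain.indicator f Z = 0 :=
      fun Z hZ => Set.indicator_of_notMem hZ f
    refine ⟨hd, h0, (measurable_of_differentiableOn hd h0).aestronglyMeasurable, ?_⟩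
    refine (ENNReal.pow_lt_top_iff.1 ?_).resolve_right two_ne_zero
    rw [eLpNorm_two_sq]
    refine lt_of_le_of_lt (lintegral_mono fun Z => ?_) hi
    gcongr
    by_cases hZ : Z ∈ cartanDomain <;> simp [hZ]⟩

theorem HolL2.mk_apply {l : ℕ} (f : Mat2 → ℂ) (hf : DifferentiableOn ℂ f cartanDomain)
    (hi : ∫⁻ Z, ‖f Z‖ₑ ^ 2 ∂(bergmanMeasure l) < ⊤) {Z : Mat2} (hZ : Z ∈ cartanDomain) :
    HolL2.mk f hf hi Z = f Z := Set.indicator_of_mem hZ f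

theorem HolL2.add_apply {l : ℕ} (φ ψ : HolL2 l) (Z : Mat2) : (φ + ψ) Z = φ Z + ψ Z := rfl

theorem HolL2.smul_apply {l : ℕ} (c : ℂ) (φ : HolL2 l) (Z : Mat2) : (c • φ) Z = c * φ Z := rfl

theorem HolL2.lintegral_lt_top {l : ℕ} (φ : HolL2 l) :
    ∫⁻ Z, ‖φ Z‖ₑ ^ 2 ∂(bergmanMeasure l) < ⊤ := by
  rw [← eLpNorm_two_sq]
  exact ENNReal.pow_lt_top φ.2.2.2.2

theorem HolL2.inner_eq {l : ℕ} [Fact (4 ≤ l)] (φ ψ : HolL2 l) :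
    inner ℂ φ ψ = ∫ Z, conj (φ Z) * ψ Z ∂(bergmanMeasure l) := rfl

theorem HolL2.enorm_sq {l : ℕ} [Fact (4 ≤ l)] (φ : HolL2 l) :
    ‖φ‖ₑ ^ 2 = ∫⁻ Z, ‖φ Z‖ₑ ^ 2 ∂(bergmanMeasure l) := by
  have h1 : ‖φ‖ ^ 2 = ∫ Z, ‖φ Z‖ ^ 2 ∂(bergmanMeasure l) := by
    rw [@norm_sq_eq_re_inner ℂ]
    have := scalarProduct_self l φ
    change (scalarProduct l φ φ).re = _
    rw [this, Complex.ofReal_re]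
    simp only [Complex.normSq_eq_norm_sq]
  rw [← ofReal_norm, ← ENNReal.ofReal_pow (norm_nonneg _), h1,
    integral_eq_lintegral_of_nonneg_ae (Filter.Eventually.of_forall fun _ => by positivity)
    (φ.measurable.norm.pow_const 2).aestronglyMeasurable]
  have h2 : ∀ Z, ENNReal.ofReal (‖φ Z‖ ^ 2) = ‖φ Z‖ₑ ^ 2 := fun Z => by
    rw [ENNReal.ofReal_pow (norm_nonneg _), ofReal_norm]
  simp only [h2]
  exact ENNReal.ofReal_toReal φ.lintegral_lt_top.ne

theorem differentiable_denominator_det (g : U22) :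
    Differentiable ℂ fun Z : Mat2 => (denominator g Z).det := by
  have h : ∀ i j, Differentiable ℂ fun Z : Mat2 => Z i j := fun i j =>
    (LinearMap.toContinuousLinearMap (Matrix.entryLinearMap ℂ ℂ i j)).differentiable
  simp only [denominator, Matrix.det_fin_two, Matrix.sub_apply, Matrix.mul_apply,
    Fin.sum_univ_two]
  have := h 0 0
  have := h 0 1
  have := h 1 0
  have := h 1 1
  fun_prop

/-- The function `det(D† - B† Z)^{-l} f(g⁻¹ Z)`. -/
def translate (l : ℕ) (g : U22) (f : Mat2 → ℂ) (Z : Mat2) : ℂ :=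
  (denominator g Z).det ^ (-(l : ℤ)) * f (invAction g Z)

theorem differentiableOn_translate (l : ℕ) (g : U22) {f : Mat2 → ℂ}
    (hf : DifferentiableOn ℂ f cartanDomain) :
    DifferentiableOn ℂ (translate l g f) cartanDomain := by
  refine DifferentiableOn.mul ?_ (hf.comp (differentiableOn_invAction g)
    fun Z hZ => invAction_mem g hZ)
  exact (differentiable_denominator_det g).differentiableOn.zpow
    (Or.inl fun Z hZ => det_denominator_ne_zero g hZ)

theorem lintegral_translate (l : ℕ) (g : U22) (f : Mat2 → ℂ) :
    ∫⁻ Z, ‖translate l g f Z‖ₑ ^ 2 ∂(bergmanMeasure l) =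
      ∫⁻ Z, ‖f Z‖ₑ ^ 2 ∂(bergmanMeasure l) := by
  rw [← lintegral_invAction l g fun Z => ‖f Z‖ₑ ^ 2]
  simp only [translate, enorm_mul, mul_pow]

/-- The operator `U(g)`, as a map. -/
def repFun (l : ℕ) (g : U22) (φ : HolL2 l) : HolL2 l :=
  HolL2.mk (translate l g φ) (differentiableOn_translate l g φ.2.1)
    (by rw [lintegral_translate]; exact φ.lintegral_lt_top)

theorem repFun_apply (l : ℕ) (g : U22) (φ : HolL2 l) {Z : Mat2} (hZ : Z ∈ cartanDomain) :
    repFun l g φ Z = (denominator g Z).det ^ (-(l : ℤ)) * φ (invAction g Z) :=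
  HolL2.mk_apply _ _ _ hZ

theorem repFun_mul (l : ℕ) (g h : U22) (φ : HolL2 l) :
    repFun l (g * h) φ = repFun l g (repFun l h φ) := by
  refine HolL2.ext fun Z hZ => ?_
  rw [repFun_apply _ _ _ hZ, repFun_apply _ _ _ hZ, repFun_apply _ _ _ (invAction_mem g hZ),
    invAction_mul g h hZ, denominator_mul g h hZ, Matrix.det_mul, mul_zpow]
  ring

theorem repFun_one (l : ℕ) (φ : HolL2 l) : repFun l 1 φ = φ := by
  refine HolL2.ext fun Z hZ => ?_
  simp [repFun_apply _ _ _ hZ]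

theorem enorm_repFun (l : ℕ) [Fact (4 ≤ l)] (g : U22) (φ : HolL2 l) : ‖repFun l g φ‖ₑ = ‖φ‖ₑ := by
  have h : ‖repFun l g φ‖ₑ ^ 2 = ‖φ‖ₑ ^ 2 := by
    rw [HolL2.enorm_sq, HolL2.enorm_sq, ← lintegral_translate l g φ]
    refine lintegral_congr_ae ?_
    filter_upwards [ae_mem_cartanDomain l] with Z hZ
    rw [repFun_apply _ _ _ hZ]
    rfl
  exact (ENNReal.pow_right_strictMono two_ne_zero).injective h

/-- The unitary representation `U_l` of `U(2,2)` on `L²_h(D₄, dν_l)`. -/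
def rep (l : ℕ) [Fact (4 ≤ l)] : U22 →* (HolL2 l ≃ₗᵢ[ℂ] HolL2 l) where
  toFun g :=
    { toFun := repFun l g
      invFun := repFun l g⁻¹
      left_inv := fun φ => by rw [← repFun_mul, inv_mul_cancel, repFun_one]
      right_inv := fun φ => by rw [← repFun_mul, mul_inv_cancel, repFun_one]
      map_add' := fun φ ψ => HolL2.ext fun Z hZ => by
        rw [HolL2.add_apply, repFun_apply _ _ _ hZ, repFun_apply _ _ _ hZ, repFun_apply _ _ _ hZ,
          HolL2.add_apply, mul_add]
      map_smul' := fun c φ => HolL2.ext fun Z hZ => by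
        rw [RingHom.id_apply, HolL2.smul_apply, repFun_apply _ _ _ hZ, repFun_apply _ _ _ hZ,
          HolL2.smul_apply]
        ring
      norm_map' := fun φ => by
        have := congrArg ENNReal.toReal (enorm_repFun l g φ)
        rwa [toReal_enorm, toReal_enorm] at this }
  map_one' := LinearIsometryEquiv.ext (repFun_one l)
  map_mul' g h := LinearIsometryEquiv.ext (repFun_mul l g h)

theorem rep_apply (l : ℕ) [Fact (4 ≤ l)] (g : U22) (φ : HolL2 l) {Z : Mat2}
    (hZ : Z ∈ cartanDomain) :
    rep l g φ Z = (denominator g Z).det ^ (-(l : ℤ)) * φ (invAction g Z) :=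
  repFun_apply l g φ hZ

end Bergman

/-! ### The total mass of the Bergman measure -/

open MeasureTheory

/-- The truncated power `t₊^k`, with value `0` for `t ≤ 0` also when `k = 0`. -/
def truncPow (k : ℕ) (t : ℝ) : ENNReal := if 0 < t then ENNReal.ofReal (t ^ k) else 0

theorem measurable_truncPow (k : ℕ) : Measurable (truncPow k) :=
  Measurable.ite measurableSet_Ioi (measurable_id.pow_const k).ennreal_ofReal measurable_const

/-- The antiderivative of `r (p - q r²)^k` is `-(p - q r²)^{k+1} / (2 q (k + 1))`. -/
theorem lintegral_radial (k : ℕ) {q : ℝ} (hq : 0 < q) (p : ℝ) :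
    ∫⁻ r in Set.Ioi (0 : ℝ), ENNReal.ofReal r * truncPow k (p - q * r ^ 2) =
      truncPow (k + 1) p * ENNReal.ofReal (1 / (2 * q * (k + 1))) := by
  by_cases hp : 0 < p
  · have hR : 0 < √(p / q) := Real.sqrt_pos.2 (by positivity)
    have hR2 : q * √(p / q) ^ 2 = p := by
      rw [Real.sq_sqrt (by positivity)]
      field_simp
    have h1 : ∫⁻ r in Set.Ioi (0 : ℝ), ENNReal.ofReal r * truncPow k (p - q * r ^ 2) =
        ∫⁻ r in Set.Ioc (0 : ℝ) √(p / q), ENNReal.ofReal (r * (p - q * r ^ 2) ^ k) := by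
      rw [← lintegral_indicator measurableSet_Ioi, ← lintegral_indicator measurableSet_Ioc]
      have hne : ∀ᵐ r : ℝ, r ≠ √(p / q) := by simp [ae_iff]
      refine lintegral_congr_ae ?_
      filter_upwards [hne] with r hr
      by_cases h0 : 0 < r
      · by_cases h2 : r < √(p / q)
        · have h3 : 0 < p - q * r ^ 2 := by
            rw [← hR2]
            have := pow_lt_pow_left₀ h2 h0.le two_ne_zero
            nlinarith
          rw [Set.indicator_of_mem (show r ∈ Set.Ioi (0 : ℝ) from h0),
            Set.indicator_of_mem (show r ∈ Set.Ioc (0 : ℝ) _ from ⟨h0, h2.le⟩), truncPow, if_pos h3,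
            ENNReal.ofReal_mul h0.le]
        · have h3 : ¬ 0 < p - q * r ^ 2 := by
            rw [← hR2]
            have := pow_le_pow_left₀ hR.le (not_lt.1 h2) 2
            nlinarith
          rw [Set.indicator_of_mem (show r ∈ Set.Ioi (0 : ℝ) from h0), Set.indicator_of_notMem
            (fun h : r ∈ Set.Ioc (0 : ℝ) _ => h2 (lt_of_le_of_ne h.2 hr)), truncPow, if_neg h3,
            mul_zero]
      · rw [Set.indicator_of_notMem (show r ∉ Set.Ioi (0 : ℝ) from h0),
          Set.indicator_of_notMem (fun h => h0 h.1)]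
    have hd : ∀ r : ℝ, HasDerivAt (fun r : ℝ => -((p - q * r ^ 2) ^ (k + 1) / (2 * q * (k + 1))))
        (r * (p - q * r ^ 2) ^ k) r := by
      intro r
      have h2 := ((((hasDerivAt_pow 2 r).const_mul q).const_sub p).pow (k + 1)).div_const
        (2 * q * (k + 1)) |>.neg
      refine h2.congr_deriv ?_
      have : (k : ℝ) + 1 ≠ 0 := by positivity
      push_cast
      field_simp
    have hc : Continuous fun r : ℝ => r * (p - q * r ^ 2) ^ k := by fun_prop
    have hint := intervalIntegral.integral_eq_sub_of_hasDerivAt (a := 0) (b := √(p / q))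
      (fun r _ => hd r) (hc.intervalIntegrable _ _)
    rw [h1, ← ofReal_integral_eq_lintegral_ofReal, ← intervalIntegral.integral_of_le hR.le, hint,
      truncPow, if_pos hp, ← ENNReal.ofReal_mul (by positivity), hR2]
    · congr 1
      simp only [sub_self, zero_pow (Nat.succ_ne_zero k), zero_pow two_ne_zero, mul_zero, sub_zero,
        zero_div, neg_zero, zero_sub, neg_neg]
      ring
    · exact (hc.intervalIntegrable 0 _).1
    · filter_upwards [ae_restrict_mem measurableSet_Ioc] with r hr
      refine mul_nonneg hr.1.le (pow_nonneg ?_ _)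
      rw [← hR2]
      have := pow_le_pow_left₀ hr.1.le hr.2 2
      nlinarith
  · rw [truncPow, if_neg hp, zero_mul, lintegral_eq_zero_iff' (by
      have := measurable_truncPow k
      exact (by fun_prop : Measurable fun r : ℝ =>
        ENNReal.ofReal r * truncPow k (p - q * r ^ 2)).aemeasurable)]
    refine Filter.Eventually.of_forall fun r => ?_
    have : ¬ 0 < p - q * r ^ 2 := by nlinarith [mul_nonneg hq.le (sq_nonneg r)]
    simp [truncPow, this]

/-- The integral of a radial truncated power over `ℂ`, in polar coordinates about `-c`. -/
theorem lintegral_truncPow_complex (k : ℕ) {q : ℝ} (hq : 0 < q) (p : ℝ) (c : ℂ) :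
    ∫⁻ z : ℂ, truncPow k (p - q * ‖z + c‖ ^ 2) =
      truncPow (k + 1) p * ENNReal.ofReal (Real.pi / (q * (k + 1))) := by
  have hm := measurable_truncPow k
  rw [lintegral_add_right_eq_self (fun z : ℂ => truncPow k (p - q * ‖z‖ ^ 2)) c,
    ← Complex.lintegral_comp_polarCoord_symm]
  simp only [Complex.norm_polarCoord_symm, sq_abs, smul_eq_mul]
  have ht : polarCoord.target = Set.Ioi (0 : ℝ) ×ˢ Set.Ioo (-Real.pi) Real.pi := rfl
  rw [ht, Measure.volume_eq_prod, ← Measure.prod_restrict, lintegral_prod _ (by fun_prop)]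
  simp only [lintegral_const, Measure.restrict_apply MeasurableSet.univ, Set.univ_inter,
    Real.volume_Ioo]
  rw [lintegral_mul_const _ (by fun_prop), lintegral_radial k hq, mul_assoc,
    ← ENNReal.ofReal_mul (by positivity)]
  congr 2
  field_simp
  ring

theorem lintegral_fin_two {α : Type*} [MeasureSpace α] [SigmaFinite (volume : Measure α)]
    {F : (Fin 2 → α) → ENNReal} (hF : Measurable F) :
    ∫⁻ v, F v = ∫⁻ x, ∫⁻ y, F ![x, y] := by
  have h := (volume_preserving_finTwoArrow α).symm
  have h2 := h.lintegral_comp hF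
  rw [← h2, Measure.volume_eq_prod]
  exact lintegral_prod _ (hF.comp h.measurable).aemeasurable

/-- Sylvester's criterion for `2 × 2` matrices. -/
theorem posDef_fin_two_iff {H : Mat2} (hH : H.IsHermitian) :
    H.PosDef ↔ 0 < (H 0 0).re ∧ 0 < H.det.re := by
  refine ⟨fun h => ⟨(Complex.pos_iff.1 h.diag_pos).1, (Complex.pos_iff.1 h.det_pos).1⟩,
    fun ⟨h0, hd⟩ => ?_⟩
  have hdet := congrArg Complex.re hH.det_eq_prod_eigenvalues
  have htr := congrArg Complex.re hH.trace_eq_sum_eigenvalues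
  have h11 : 0 < (H 1 1).re := by
    have e1 : (H 0 0).im = 0 := Complex.conj_eq_iff_im.1 (hH.apply 0 0)
    have e2 : H 1 0 = conj (H 0 1) := (hH.apply 1 0).symm
    have e3 : H.det.re = (H 0 0).re * (H 1 1).re - (H 0 1).re ^ 2 - (H 0 1).im ^ 2 := by
      rw [Matrix.det_fin_two, e2]
      simp [e1]
      ring
    rw [e3] at hd
    by_contra hneg
    nlinarith [sq_nonneg (H 0 1).re, sq_nonneg (H 0 1).im]
  rw [hH.posDef_iff_eigenvalues_pos]
  simp only [Fin.prod_univ_two, Fin.sum_univ_two, Matrix.trace_fin_two, Complex.add_re,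
    Complex.coe_algebraMap, ← Complex.ofReal_mul, ← Complex.ofReal_add, Complex.ofReal_re]
    at hdet htr
  rw [hdet] at hd
  have hs : 0 < hH.eigenvalues 0 + hH.eigenvalues 1 := by
    have : (H 0 0).re + (H 1 1).re = hH.eigenvalues 0 + hH.eigenvalues 1 := by simpa using htr
    linarith
  intro i
  rcases pos_and_pos_or_neg_and_neg_of_mul_pos hd with h | h
  · fin_cases i
    exacts [h.1, h.2]
  · linarith [h.1, h.2]

theorem mem_cartanDomain_rows (Z : Mat2) :
    Z ∈ cartanDomain ↔ 0 < 1 - ‖Z 0 0‖ ^ 2 - ‖Z 0 1‖ ^ 2 ∧ 0 < detOne Z := by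
  rw [cartanDomain, Set.mem_ofPred_eq, posDef_fin_two_iff
    (Matrix.isHermitian_one.sub (Matrix.isHermitian_mul_conjTranspose_self Z)), detOne]
  simp only [Matrix.sub_apply, Matrix.mul_apply, Fin.sum_univ_two, Matrix.conjTranspose_apply,
    Complex.star_def, Complex.mul_conj, Matrix.one_apply_eq, Complex.normSq_eq_norm_sq]
  norm_num
  intro _
  norm_cast
  rw [lt_sub_iff_add_lt']

/-- Completing the square in the last entry of `Z`. -/
theorem detOne_eq (Z : Mat2) (ha : 1 - ‖Z 0 0‖ ^ 2 ≠ 0) :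
    detOne Z = (1 - ‖Z 0 0‖ ^ 2 - ‖Z 0 1‖ ^ 2) -
      (1 - ‖Z 0 0‖ ^ 2 - ‖Z 0 1‖ ^ 2) / (1 - ‖Z 0 0‖ ^ 2) * ‖Z 1 0 + 0‖ ^ 2 -
      (1 - ‖Z 0 0‖ ^ 2) * ‖Z 1 1 +
        (((1 - ‖Z 0 0‖ ^ 2)⁻¹ : ℝ) : ℂ) * (conj (Z 0 0) * Z 0 1 * Z 1 0)‖ ^ 2 := by
  set a := 1 - ‖Z 0 0‖ ^ 2 with ha'
  have h1 : ‖Z 1 1 + ((a⁻¹ : ℝ) : ℂ) * (conj (Z 0 0) * Z 0 1 * Z 1 0)‖ ^ 2 =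
      (a⁻¹) ^ 2 * ‖(a : ℂ) * Z 1 1 + conj (Z 0 0) * Z 0 1 * Z 1 0‖ ^ 2 := by
    rw [← sq_abs a⁻¹, ← Real.norm_eq_abs, ← Complex.norm_real, ← mul_pow, ← norm_mul, mul_add,
      ← mul_assoc _ (a : ℂ), ← Complex.ofReal_mul, inv_mul_cancel₀ ha]
    simp
  rw [h1]
  field_simp
  rw [ha']
  simp only [detOne, Matrix.det_fin_two, Matrix.sub_apply, Matrix.mul_apply, Fin.sum_univ_two,
    Matrix.conjTranspose_apply, ← Complex.normSq_eq_norm_sq, Complex.normSq_apply,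
    Complex.star_def, Matrix.one_apply, Complex.add_re, Complex.add_im, Complex.mul_re,
    Complex.mul_im, Complex.sub_re, Complex.sub_im, Complex.conj_re, Complex.conj_im,
    Complex.ofReal_re, Complex.ofReal_im]
  norm_num
  ring

/-- The integral over the second row of `Z`, for a fixed first row `u` in the unit ball. -/
theorem lintegral_row (k : ℕ) (u : Fin 2 → ℂ) (hu : 0 < 1 - ‖u 0‖ ^ 2 - ‖u 1‖ ^ 2) :
    ∫⁻ v : Fin 2 → ℂ, truncPow k (detOne (Matrix.of ![u, v])) =
      truncPow (k + 1) (1 - ‖u 0‖ ^ 2 - ‖u 1‖ ^ 2) *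
        ENNReal.ofReal (Real.pi ^ 2 / ((k + 1) * (k + 2))) := by
  have ha : 0 < 1 - ‖u 0‖ ^ 2 := by nlinarith [sq_nonneg ‖u 1‖]
  have hcont : Continuous fun v : Fin 2 → ℂ => detOne (Matrix.of ![u, v]) := by
    have h0 : Continuous fun v : Fin 2 → ℂ => (Matrix.of ![u, v] : Mat2) := by
      refine continuous_pi fun i => ?_
      fin_cases i
      · exact continuous_const
      · exact continuous_id
    exact Complex.continuous_re.comp (continuous_const.sub
      (h0.matrix_mul h0.matrix_conjTranspose)).matrix_det
  refine (lintegral_fin_two ((measurable_truncPow k).comp hcont.measurable)).trans ?_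
  simp only [Function.comp_apply]
  set b := 1 - ‖u 0‖ ^ 2 - ‖u 1‖ ^ 2 with hb
  set a := 1 - ‖u 0‖ ^ 2 with ha'
  have h1 : ∀ x y : ℂ, detOne (Matrix.of ![u, ![x, y]]) = b - b / a * ‖x + 0‖ ^ 2 -
      a * ‖y + ((a⁻¹ : ℝ) : ℂ) * (conj (u 0) * u 1 * x)‖ ^ 2 := fun x y =>
    detOne_eq (Matrix.of ![u, ![x, y]]) ha.ne'
  simp only [h1, lintegral_truncPow_complex k ha]
  have hm := measurable_truncPow (k + 1)
  rw [lintegral_mul_const _ (by fun_prop), lintegral_truncPow_complex (k + 1) (div_pos hu ha),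
    mul_assoc, ← ENNReal.ofReal_mul (by positivity), truncPow, truncPow, if_pos hu, if_pos hu,
    ← ENNReal.ofReal_mul (by positivity), ← ENNReal.ofReal_mul (by positivity)]
  congr 1
  push_cast
  field_simp
  ring

theorem lintegral_ball (k : ℕ) : ∫⁻ u : Fin 2 → ℂ, truncPow k (1 - ‖u 0‖ ^ 2 - ‖u 1‖ ^ 2) =
    ENNReal.ofReal (Real.pi ^ 2 / ((k + 1) * (k + 2))) := by
  have hm := measurable_truncPow
  rw [lintegral_fin_two (by fun_prop)]
  have h1 : ∀ p : ℝ, ∀ q : ℝ, ∀ y : ℂ, truncPow k (p - ‖y‖ ^ 2) =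
      truncPow k (p - 1 * ‖y + 0‖ ^ 2) := by simp
  have h2 : ∀ y : ℂ, 1 - ‖y‖ ^ 2 = 1 - 1 * ‖y + 0‖ ^ 2 := by simp
  simp only [Matrix.cons_val_zero, Matrix.cons_val_one, h1 _ 0,
    lintegral_truncPow_complex k one_pos]
  simp only [h2]
  rw [lintegral_mul_const _ (by fun_prop), lintegral_truncPow_complex (k + 1) one_pos, truncPow,
    if_pos one_pos, ← ENNReal.ofReal_mul (by positivity), ← ENNReal.ofReal_mul (by positivity)]
  congr 1
  push_cast
  field_simp
  ring

theorem measurable_detOne : Measurable detOne :=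
  (Complex.continuous_re.comp (continuous_const.sub
    (continuous_id.matrix_mul continuous_id.matrix_conjTranspose)).matrix_det).measurable

theorem setLIntegral_detOne_pow (k : ℕ) :
    ∫⁻ Z in cartanDomain, ENNReal.ofReal (detOne Z ^ k) =
      ENNReal.ofReal (Real.pi ^ 4 / ((k + 1) * (k + 2) ^ 2 * (k + 3))) := by
  classical
  rw [← lintegral_indicator isOpen_cartanDomain.measurableSet]
  have h1 : ∀ Z : Mat2, cartanDomain.indicator (fun Z => ENNReal.ofReal (detOne Z ^ k)) Z =
      if 0 < 1 - ‖Z 0 0‖ ^ 2 - ‖Z 0 1‖ ^ 2 then truncPow k (detOne Z) else 0 := by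
    intro Z
    simp only [Set.indicator_apply, mem_cartanDomain_rows, truncPow, ite_and]
  simp only [h1]
  have hmZ : Measurable fun Z : Fin 2 → Fin 2 → ℂ =>
      if 0 < 1 - ‖Z 0 0‖ ^ 2 - ‖Z 0 1‖ ^ 2 then truncPow k (detOne Z) else 0 :=
    Measurable.ite (measurableSet_lt measurable_const (by fun_prop))
      ((measurable_truncPow k).comp measurable_detOne) measurable_const
  refine (lintegral_fin_two hmZ).trans ?_
  have h2 : ∀ u : Fin 2 → ℂ, ∫⁻ v : Fin 2 → ℂ, (if 0 < 1 - ‖(![u, v] : Fin 2 → Fin 2 → ℂ) 0 0‖ ^ 2 -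
      ‖(![u, v] : Fin 2 → Fin 2 → ℂ) 0 1‖ ^ 2 then truncPow k (detOne ![u, v]) else 0) =
      truncPow (k + 1) (1 - ‖u 0‖ ^ 2 - ‖u 1‖ ^ 2) *
        ENNReal.ofReal (Real.pi ^ 2 / ((k + 1) * (k + 2))) := by
    intro u
    by_cases hu : 0 < 1 - ‖u 0‖ ^ 2 - ‖u 1‖ ^ 2
    · rw [← lintegral_row k u hu]
      refine lintegral_congr fun v => ?_
      exact if_pos hu
    · rw [truncPow, if_neg hu, zero_mul]
      refine (lintegral_congr fun v => ?_).trans lintegral_zero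
      exact if_neg hu
  simp only [h2]
  have hm := measurable_truncPow
  rw [lintegral_mul_const _ (by fun_prop), lintegral_ball, ← ENNReal.ofReal_mul (by positivity)]
  congr 1
  push_cast
  field_simp
  ring

theorem bergmanMeasure_univ (l : ℕ) (hl : 4 ≤ l) : bergmanMeasure l Set.univ = 1 := by
  obtain ⟨k, rfl⟩ := Nat.exists_eq_add_of_le' hl
  rw [← lintegral_one, lintegral_bergmanMeasure]
  have h1 : ∀ Z ∈ cartanDomain, ENNReal.ofReal (density (k + 4) Z) * 1 =
      ENNReal.ofReal (normConst (k + 4)) * ENNReal.ofReal (detOne Z ^ k) := by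
    intro Z hZ
    rw [mul_one, density_eq, ENNReal.ofReal_mul' (zpow_nonneg (detOne_pos hZ).le _)]
    congr 2
    rw [← zpow_natCast]
    congr 1
    push_cast
    ring
  rw [setLIntegral_congr_fun isOpen_cartanDomain.measurableSet h1,
    lintegral_const_mul _ (measurable_detOne.pow_const k).ennreal_ofReal, setLIntegral_detOne_pow,
    ← ENNReal.ofReal_mul' (by positivity), ← ENNReal.ofReal_one, normConst]
  congr 1
  push_cast
  field_simp
  ring

instance (l : ℕ) [hl : Fact (4 ≤ l)] : IsProbabilityMeasure (bergmanMeasure l) :=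
  ⟨bergmanMeasure_univ l hl.out⟩

section Bergman

attribute [local instance] Matrix.normedAddCommGroup Matrix.normedSpace

open MeasureTheory Filter Topology

/-! ### The reproducing property at the origin -/

/-- The constant function `1`. -/
def oneFun (l : ℕ) [Fact (4 ≤ l)] : HolL2 l :=
  HolL2.mk (fun _ => 1) (differentiableOn_const 1) (by simp)

theorem oneFun_apply (l : ℕ) [Fact (4 ≤ l)] {Z : Mat2} (hZ : Z ∈ cartanDomain) :
    oneFun l Z = 1 := HolL2.mk_apply _ _ _ hZ

theorem norm_oneFun (l : ℕ) [Fact (4 ≤ l)] : ‖oneFun l‖ = 1 := by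
  have h : ‖oneFun l‖ₑ ^ 2 = 1 := by
    rw [HolL2.enorm_sq, ← measure_univ (μ := bergmanMeasure l), ← lintegral_one]
    refine lintegral_congr_ae ?_
    filter_upwards [ae_mem_cartanDomain l] with Z hZ
    simp [oneFun_apply l hZ]
  have h2 : ‖oneFun l‖ₑ = 1 := by
    rw [← one_pow 2] at h
    exact (ENNReal.pow_right_strictMono two_ne_zero).injective h
  rw [← toReal_enorm, h2, ENNReal.toReal_one]

/-- The element `diag(e^{-iθ}, 1)`, which acts by `Z ↦ e^{iθ} Z` with trivial automorphy factor. -/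
def rotation (θ : ℝ) : U22 :=
  ofForm (Matrix.fromBlocks (Complex.exp (-(θ * Complex.I)) • 1) 0 0 1) (by
    have h : star (Complex.exp (-(θ * Complex.I))) * Complex.exp (-(θ * Complex.I)) = 1 := by
      rw [Complex.star_def, Complex.conj_mul', ← neg_mul, ← Complex.ofReal_neg,
        Complex.norm_exp_ofReal_mul_I]
      simp
    rw [Matrix.fromBlocks_conjTranspose, gamma5, Matrix.fromBlocks_multiply,
      Matrix.fromBlocks_multiply]
    simp only [Matrix.conjTranspose_smul, Matrix.conjTranspose_one]
    congr 1
    · simp only [Matrix.conjTranspose_zero, mul_neg, mul_one, mul_zero, add_zero,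
        Matrix.mul_smul, smul_smul, neg_mul, mul_comm (Complex.exp _)]
      rw [h, one_smul]
    all_goals simp)

theorem denominator_rotation (θ : ℝ) (Z : Mat2) : denominator (rotation θ) Z = 1 := by
  simp [denominator, blockB, blockD, rotation, ofForm]

theorem invAction_rotation (θ : ℝ) (Z : Mat2) :
    invAction (rotation θ) Z = Complex.exp (θ * Complex.I) • Z := by
  rw [invAction, denominator_rotation]
  simp [blockA, blockC, rotation, ofForm, ← Complex.exp_conj]

theorem rep_rotation_apply (l : ℕ) [Fact (4 ≤ l)] (θ : ℝ) (φ : HolL2 l) {Z : Mat2}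
    (hZ : Z ∈ cartanDomain) : rep l (rotation θ) φ Z = φ (Complex.exp (θ * Complex.I) • Z) := by
  rw [rep_apply _ _ _ hZ, denominator_rotation, invAction_rotation]
  simp

/-- The domain is circled: `I - |ζ|² ZZ† = (I - ZZ†) + (1 - |ζ|²) ZZ†`. -/
theorem smul_mem_cartanDomain {Z : Mat2} (hZ : Z ∈ cartanDomain) {ζ : ℂ} (hζ : ‖ζ‖ ≤ 1) :
    ζ • Z ∈ cartanDomain := by
  have h1 : (1 - Z * Zᴴ).PosDef := hZ
  have h2 : (((1 - ‖ζ‖ ^ 2 : ℝ) : ℂ) • (Z * Zᴴ)).PosSemidef :=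
    (Matrix.posSemidef_self_mul_conjTranspose Z).smul
      (by exact_mod_cast sub_nonneg.2 (pow_le_one₀ (norm_nonneg _) hζ))
  have h3 : 1 - (ζ • Z) * (ζ • Z)ᴴ = (1 - Z * Zᴴ) + ((1 - ‖ζ‖ ^ 2 : ℝ) : ℂ) • (Z * Zᴴ) := by
    have : ζ * star ζ = ((‖ζ‖ ^ 2 : ℝ) : ℂ) := by
      rw [Complex.star_def, Complex.mul_conj']; norm_cast
    rw [Matrix.conjTranspose_smul, smul_mul_smul_comm, this]
    push_cast
    module
  rw [cartanDomain, Set.mem_ofPred_eq, h3]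
  exact h1.add_posSemidef h2

/-- The mean value property on the disc `ζ ↦ ζ Z`. -/
theorem mean_value {l : ℕ} (φ : HolL2 l) {Z : Mat2} (hZ : Z ∈ cartanDomain) :
    (2 * Real.pi)⁻¹ • ∫ θ in (0 : ℝ)..2 * Real.pi, φ (Complex.exp (θ * Complex.I) • Z) = φ 0 := by
  have hd : ∀ ζ ∈ Metric.closedBall (0 : ℂ) 1, DifferentiableAt ℂ (fun ζ : ℂ => φ (ζ • Z)) ζ := by
    intro ζ hζ
    have hm := smul_mem_cartanDomain hZ (mem_closedBall_zero_iff.1 hζ)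
    have h1 := (φ.2.1 _ hm).differentiableAt (isOpen_cartanDomain.mem_nhds hm)
    exact h1.comp ζ (differentiableAt_id.smul_const Z)
  have h := DiffContOnCl.circleAverage (f := fun ζ : ℂ => φ (ζ • Z)) (c := 0) (R := 1)
    (DifferentiableOn.diffContOnCl fun ζ hζ => (hd ζ (by
      rw [abs_one] at hζ; exact Metric.closure_ball_subset_closedBall hζ)).differentiableWithinAt)
  simpa [Real.circleAverage, circleMap] using h

theorem HolL2.integrable {l : ℕ} [Fact (4 ≤ l)] (φ : HolL2 l) :
    Integrable φ (bergmanMeasure l) := φ.2.2.2.integrable one_le_two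

theorem inner_oneFun_eq_integral (l : ℕ) [Fact (4 ≤ l)] (φ : HolL2 l) :
    inner ℂ (oneFun l) φ = ∫ Z, φ Z ∂(bergmanMeasure l) := by
  rw [HolL2.inner_eq]
  refine integral_congr_ae ?_
  filter_upwards [ae_mem_cartanDomain l] with Z hZ
  simp [oneFun_apply l hZ]

theorem rep_rotation_oneFun (l : ℕ) [Fact (4 ≤ l)] (θ : ℝ) :
    rep l (rotation θ) (oneFun l) = oneFun l := by
  refine HolL2.ext fun Z hZ => ?_
  rw [rep_rotation_apply l θ _ hZ, oneFun_apply l hZ,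
    oneFun_apply l (smul_mem_cartanDomain hZ (Complex.norm_exp_ofReal_mul_I θ).le)]

theorem integral_rotation (l : ℕ) [Fact (4 ≤ l)] (θ : ℝ) (φ : HolL2 l) :
    ∫ Z, φ (Complex.exp (θ * Complex.I) • Z) ∂(bergmanMeasure l) =
      ∫ Z, φ Z ∂(bergmanMeasure l) := by
  rw [← inner_oneFun_eq_integral, ← (rep l (rotation θ)).inner_map_map, rep_rotation_oneFun,
    inner_oneFun_eq_integral]
  refine integral_congr_ae ?_
  filter_upwards [ae_mem_cartanDomain l] with Z hZ
  rw [rep_rotation_apply l θ φ hZ]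

/-- Averaging over the rotations `Z ↦ e^{iθ} Z` shows that `1` reproduces the value at `0`. -/
theorem inner_oneFun (l : ℕ) [Fact (4 ≤ l)] (φ : HolL2 l) : inner ℂ (oneFun l) φ = φ 0 := by
  have hint : Integrable (Function.uncurry fun (θ : ℝ) (Z : Mat2) =>
      φ (Complex.exp (θ * Complex.I) • Z))
      ((volume.restrict (Set.Ioc 0 (2 * Real.pi))).prod (bergmanMeasure l)) := by
    have hm : Measurable (Function.uncurry fun (θ : ℝ) (Z : Mat2) =>
        φ (Complex.exp (θ * Complex.I) • Z)) := by
      refine φ.measurable.comp ?_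
      refine Measurable.fun_smul ?_ measurable_snd
      fun_prop
    refine ⟨hm.aestronglyMeasurable, ?_⟩
    rw [HasFiniteIntegral, lintegral_prod _ hm.enorm.aemeasurable]
    have hrot : ∀ θ : ℝ, ∫⁻ Z, ‖φ (Complex.exp (θ * Complex.I) • Z)‖ₑ ∂(bergmanMeasure l) =
        ∫⁻ Z, ‖φ Z‖ₑ ∂(bergmanMeasure l) := by
      intro θ
      rw [← lintegral_invAction l (rotation θ) fun Z => ‖φ Z‖ₑ]
      simp [denominator_rotation, invAction_rotation]
    simp only [Function.uncurry, hrot]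
    rw [lintegral_const, Measure.restrict_apply_univ, Real.volume_Ioc]
    exact ENNReal.mul_lt_top φ.integrable.2 ENNReal.ofReal_lt_top
  have hswap := integral_integral_swap hint
  simp only [integral_rotation] at hswap
  rw [integral_const, measureReal_restrict_apply_univ, Real.volume_real_Ioc_of_le
    (by positivity), sub_zero] at hswap
  have h2 : ∀ Z ∈ cartanDomain, ∫ θ in Set.Ioc 0 (2 * Real.pi),
      φ (Complex.exp (θ * Complex.I) • Z) = (2 * Real.pi) • φ 0 := by
    intro Z hZ
    rw [← mean_value φ hZ, intervalIntegral.integral_of_le (by positivity),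
      smul_inv_smul₀ (by positivity)]
  have h3 : ∫ Z, (∫ θ in Set.Ioc 0 (2 * Real.pi), φ (Complex.exp (θ * Complex.I) • Z))
      ∂(bergmanMeasure l) = ∫ _, (2 * Real.pi) • φ 0 ∂(bergmanMeasure l) :=
    integral_congr_ae (by filter_upwards [ae_mem_cartanDomain l] with Z hZ using h2 Z hZ)
  rw [h3, integral_const, probReal_univ, one_smul] at hswap
  rw [inner_oneFun_eq_integral]
  exact smul_right_injective ℂ (by positivity : (2 * Real.pi : ℝ) ≠ 0) hswap

/-! ### Completeness -/

/-- The representation moves the evaluation at `Z` to the evaluation at `0`. -/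
theorem exists_eval_eq (l : ℕ) [Fact (4 ≤ l)] {Z : Mat2} (hZ : Z ∈ cartanDomain) :
    ∃ h : U22, detOne Z * ‖(denominator h 0).det‖ ^ 2 = 1 ∧
      ∀ φ : HolL2 l, φ Z = (denominator h 0).det ^ l * inner ℂ (oneFun l) (rep l h φ) := by
  obtain ⟨h, -, hh⟩ := exists_hermitian_boost hZ
  refine ⟨h⁻¹, ?_, fun φ => ?_⟩
  · rw [← detOne_zero, ← detOne_invAction h⁻¹ zero_mem_cartanDomain, hh]
  · rw [inner_oneFun, rep_apply _ _ _ zero_mem_cartanDomain, hh, ← mul_assoc, zpow_neg,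
      zpow_natCast, mul_inv_cancel₀ (pow_ne_zero _ (det_denominator_ne_zero _
        zero_mem_cartanDomain)), one_mul]

/-- Point evaluations are bounded, by `det(I - ZZ†)^{-l/2}`. -/
theorem norm_apply_sq_le (l : ℕ) [Fact (4 ≤ l)] (φ : HolL2 l) {Z : Mat2} (hZ : Z ∈ cartanDomain) :
    ‖φ Z‖ ^ 2 * detOne Z ^ l ≤ ‖φ‖ ^ 2 := by
  obtain ⟨h, h1, h2⟩ := exists_eval_eq l hZ
  have h3 : ‖inner ℂ (oneFun l) (rep l h φ)‖ ≤ ‖φ‖ := by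
    refine (norm_inner_le_norm _ _).trans ?_
    rw [norm_oneFun, one_mul, LinearIsometryEquiv.norm_map]
  rw [h2 φ, norm_mul, norm_pow, mul_pow, ← pow_mul, mul_comm l 2, pow_mul, mul_right_comm,
    ← mul_pow, mul_comm _ (detOne Z), h1, one_pow, one_mul]
  gcongr

theorem exists_eval_bound (l : ℕ) [Fact (4 ≤ l)] {K : Set Mat2} (hK : IsCompact K)
    (hKD : K ⊆ cartanDomain) : ∃ C : ℝ, 0 ≤ C ∧ ∀ Z ∈ K, ∀ φ : HolL2 l, ‖φ Z‖ ≤ C * ‖φ‖ := by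
  rcases K.eq_empty_or_nonempty with rfl | hne
  · exact ⟨0, le_rfl, by simp⟩
  have hc : ContinuousOn detOne K := (Complex.continuous_re.comp (continuous_const.sub
    (continuous_id.matrix_mul continuous_id.matrix_conjTranspose)).matrix_det).continuousOn
  obtain ⟨Z₀, hZ₀, hmin⟩ := hK.exists_isMinOn hne hc
  have hpos := detOne_pos (hKD hZ₀)
  refine ⟨√((detOne Z₀ ^ l)⁻¹), Real.sqrt_nonneg _, fun Z hZ φ => ?_⟩
  have h1 := norm_apply_sq_le l φ (hKD hZ)
  have h2 : ‖φ Z‖ ^ 2 * detOne Z₀ ^ l ≤ ‖φ‖ ^ 2 := by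
    refine le_trans ?_ h1
    have := hmin hZ
    gcongr
    exact this
  refine abs_le_of_sq_le_sq' ?_ (by positivity) |>.2
  rw [mul_pow, Real.sq_sqrt (by positivity), inv_mul_eq_div, le_div_iff₀ (by positivity)]
  exact h2

/-- The Cauchy estimate for the Fréchet derivative, by restriction to complex lines. -/
theorem norm_fderiv_le_of_forall_closedBall {E : Type*} [NormedAddCommGroup E] [NormedSpace ℂ E]
    {f : E → ℂ} {x : E} {r C : ℝ} (hr : 0 < r) (hC : 0 ≤ C)
    (hf : ∀ y ∈ Metric.closedBall x r, DifferentiableAt ℂ f y)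
    (hb : ∀ y ∈ Metric.closedBall x r, ‖f y‖ ≤ C) : ‖fderiv ℂ f x‖ ≤ C / r := by
  refine ContinuousLinearMap.opNorm_le_bound _ (by positivity) fun v => ?_
  rcases eq_or_ne v 0 with rfl | hv
  · simp
  have hv' : 0 < ‖v‖ := norm_pos_iff.2 hv
  have hmem : ∀ ζ ∈ Metric.closedBall (0 : ℂ) (r / ‖v‖), x + ζ • v ∈ Metric.closedBall x r := by
    intro ζ hζ
    rw [mem_closedBall_zero_iff, le_div_iff₀ hv'] at hζ
    simpa [norm_smul] using hζ
  have hline : ∀ ζ : ℂ, HasDerivAt (fun ζ : ℂ => x + ζ • v) v ζ := fun ζ => by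
    simpa using ((hasDerivAt_id ζ).smul_const v).const_add x
  have hd : ∀ ζ ∈ Metric.closedBall (0 : ℂ) (r / ‖v‖),
      DifferentiableAt ℂ (fun ζ : ℂ => f (x + ζ • v)) ζ := fun ζ hζ =>
    (hf _ (hmem ζ hζ)).comp ζ (hline ζ).differentiableAt
  have h1 := Complex.norm_deriv_le_of_forall_mem_sphere_norm_le (c := 0) (R := r / ‖v‖) (C := C)
    (f := fun ζ : ℂ => f (x + ζ • v)) (by positivity)
    (DifferentiableOn.diffContOnCl fun ζ hζ =>
      (hd ζ (Metric.closure_ball_subset_closedBall hζ)).differentiableWithinAt)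
    (fun ζ hζ => hb _ (hmem ζ (Metric.sphere_subset_closedBall hζ)))
  have h2 : HasDerivAt (fun ζ : ℂ => f (x + ζ • v)) (fderiv ℂ f x v) 0 := by
    have hx := (hf x (Metric.mem_closedBall_self hr.le)).hasFDerivAt
    have hx' : HasFDerivAt f (fderiv ℂ f x) (x + (0 : ℂ) • v) := by simpa using hx
    exact hx'.comp_hasDerivAt 0 (hline 0)
  rw [h2.deriv] at h1
  calc _ ≤ C / (r / ‖v‖) := h1
    _ = C / r * ‖v‖ := by field_simp

/-- Pointwise limits of locally uniformly Cauchy sequences of holomorphic functions on an open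
subset of a complex normed space are holomorphic: by the Cauchy estimate the derivatives converge
locally uniformly. -/
theorem differentiableOn_of_uniformCauchySeqOn {E : Type*} [NormedAddCommGroup E]
    [NormedSpace ℂ E] {s : Set E} (hs : IsOpen s) {F : ℕ → E → ℂ} {f : E → ℂ}
    (hF : ∀ n, DifferentiableOn ℂ (F n) s)
    (hcau : ∀ x ∈ s, ∃ R > 0, Metric.closedBall x R ⊆ s ∧
      UniformCauchySeqOn F atTop (Metric.closedBall x R))
    (hf : ∀ x ∈ s, Tendsto (fun n => F n x) atTop (𝓝 (f x))) : DifferentiableOn ℂ f s := by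
  intro x₀ hx₀
  obtain ⟨R, hR, hball, hu⟩ := hcau x₀ hx₀
  have hr : 0 < R / 2 := by positivity
  have hsub : ∀ x ∈ Metric.ball x₀ (R / 2), Metric.closedBall x (R / 2) ⊆
      Metric.closedBall x₀ R := fun x hx => Metric.closedBall_subset_closedBall' (by
    have := (Metric.mem_ball.1 hx).le
    linarith)
  have hmem : ∀ x ∈ Metric.ball x₀ (R / 2), x ∈ s := fun x hx =>
    hball (hsub x hx (Metric.mem_closedBall_self hr.le))
  have hdiff : ∀ n, ∀ x ∈ s, DifferentiableAt ℂ (F n) x := fun n x hx =>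
    (hF n x hx).differentiableAt (hs.mem_nhds hx)
  have hcauchy : UniformCauchySeqOn (fun n x => fderiv ℂ (F n) x) atTop
      (Metric.ball x₀ (R / 2)) := by
    rw [Metric.uniformCauchySeqOn_iff] at hu ⊢
    intro ε hε
    obtain ⟨N, hN⟩ := hu (ε * (R / 2) / 2) (by positivity)
    refine ⟨N, fun m hm n hn x hx => ?_⟩
    have h1 : fderiv ℂ (F m) x - fderiv ℂ (F n) x = fderiv ℂ (F m - F n) x :=
      (fderiv_sub (hdiff m x (hmem x hx)) (hdiff n x (hmem x hx))).symm
    rw [dist_eq_norm, h1]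
    refine (norm_fderiv_le_of_forall_closedBall hr (C := ε * (R / 2) / 2) (by positivity)
      (fun y hy => (hdiff m y (hball (hsub x hx hy))).sub (hdiff n y (hball (hsub x hx hy))))
      (fun y hy => ?_)).trans_lt ?_
    · rw [Pi.sub_apply, ← dist_eq_norm]
      exact (hN m hm n hn y (hsub x hx hy)).le
    · have : ε * (R / 2) / 2 / (R / 2) = ε / 2 := by field_simp
      rw [this]
      linarith
  have hlim : ∀ x, ∃ g : E →L[ℂ] ℂ, x ∈ Metric.ball x₀ (R / 2) →
      Tendsto (fun n => fderiv ℂ (F n) x) atTop (𝓝 g) := by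
    intro x
    by_cases hx : x ∈ Metric.ball x₀ (R / 2)
    · obtain ⟨g, hg⟩ := cauchySeq_tendsto_of_complete (hcauchy.cauchySeq hx)
      exact ⟨g, fun _ => hg⟩
    · exact ⟨0, fun h => absurd h hx⟩
  choose g hg using hlim
  have hunif := hcauchy.tendstoUniformlyOn_of_tendsto (f := g) fun x hx => hg x hx
  have := hasFDerivAt_of_tendstoUniformlyOn Metric.isOpen_ball hunif
    (fun n x hx => (hdiff n x (hmem x hx)).hasFDerivAt)
    (fun x hx => hf x (hmem x hx)) (Metric.mem_ball_self hr)
  exact this.differentiableAt.differentiableWithinAt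

theorem HolL2.sub_apply {l : ℕ} (φ ψ : HolL2 l) (Z : Mat2) : (φ - ψ) Z = φ Z - ψ Z := rfl

theorem uniformCauchySeqOn_of_cauchySeq (l : ℕ) [Fact (4 ≤ l)] {u : ℕ → HolL2 l} (hu : CauchySeq u)
    {K : Set Mat2} (hK : IsCompact K) (hKD : K ⊆ cartanDomain) :
    UniformCauchySeqOn (fun n Z => u n Z) atTop K := by
  obtain ⟨C, hC, hb⟩ := exists_eval_bound l hK hKD
  rw [Metric.uniformCauchySeqOn_iff]
  intro ε hε
  obtain ⟨N, hN⟩ := Metric.cauchySeq_iff.1 hu (ε / (C + 1)) (by positivity)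
  refine ⟨N, fun m hm n hn Z hZ => ?_⟩
  have h2 := hN m hm n hn
  rw [dist_eq_norm, lt_div_iff₀ (by positivity)] at h2
  rw [dist_eq_norm, ← HolL2.sub_apply]
  refine (hb Z hZ _).trans_lt (lt_of_le_of_lt ?_ h2)
  rw [mul_comm]
  gcongr
  linarith

/-- Pointwise limits of Cauchy sequences in `L²_h` are holomorphic. -/
theorem differentiableOn_of_cauchySeq (l : ℕ) [Fact (4 ≤ l)] {u : ℕ → HolL2 l} (hu : CauchySeq u)
    {f : Mat2 → ℂ} (hf : ∀ Z ∈ cartanDomain, Tendsto (fun n => u n Z) atTop (𝓝 (f Z))) :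
    DifferentiableOn ℂ f cartanDomain := by
  refine differentiableOn_of_uniformCauchySeqOn (F := fun n Z => u n Z) isOpen_cartanDomain
    (fun n => (u n).2.1) (fun Z hZ => ?_) hf
  obtain ⟨R, hR, hball⟩ := Metric.nhds_basis_closedBall.mem_iff.1
    (isOpen_cartanDomain.mem_nhds hZ)
  exact ⟨R, hR, hball, uniformCauchySeqOn_of_cauchySeq l hu (isCompact_closedBall Z R) hball⟩

theorem completeSpace_holL2 (l : ℕ) [Fact (4 ≤ l)] : CompleteSpace (HolL2 l) := by
  refine Metric.complete_of_cauchySeq_tendsto fun u hu => ?_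
  have hlim : ∀ Z, ∃ w : ℂ, Z ∈ cartanDomain → Tendsto (fun n => u n Z) atTop (𝓝 w) := by
    intro Z
    by_cases hZ : Z ∈ cartanDomain
    · have := (uniformCauchySeqOn_of_cauchySeq l hu (isCompact_singleton (x := Z))
        (Set.singleton_subset_iff.2 hZ)).cauchySeq (Set.mem_singleton Z)
      obtain ⟨w, hw⟩ := cauchySeq_tendsto_of_complete this
      exact ⟨w, fun _ => hw⟩
    · exact ⟨0, fun h => absurd h hZ⟩
  choose f hf using hlim
  have hd := differentiableOn_of_cauchySeq l hu hf
  -- Fatou's lemma bounds the distance to the limit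
  have hfatou : ∀ ε : ℝ, 0 < ε → ∃ N, ∀ n ≥ N,
      ∫⁻ Z, ‖u n Z - f Z‖ₑ ^ 2 ∂(bergmanMeasure l) ≤ ENNReal.ofReal ε ^ 2 := by
    intro ε hε
    obtain ⟨N, hN⟩ := Metric.cauchySeq_iff.1 hu ε hε
    refine ⟨N, fun n hn => ?_⟩
    have h1 : ∫⁻ Z, ‖u n Z - f Z‖ₑ ^ 2 ∂(bergmanMeasure l) =
        ∫⁻ Z, liminf (fun m => ‖u n Z - u m Z‖ₑ ^ 2) atTop ∂(bergmanMeasure l) := by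
      refine lintegral_congr_ae ?_
      filter_upwards [ae_mem_cartanDomain l] with Z hZ
      refine (Tendsto.liminf_eq ?_).symm
      exact (ENNReal.continuous_pow 2).continuousAt.tendsto.comp
        (tendsto_const_nhds.sub (hf Z hZ)).enorm
    rw [h1]
    refine (lintegral_liminf_le fun m =>
      ((u n).measurable.sub (u m).measurable).enorm.pow_const 2).trans ?_
    refine liminf_le_of_frequently_le' (Eventually.frequently ?_)
    filter_upwards [eventually_ge_atTop N] with m hm
    have h2 := HolL2.enorm_sq (u n - u m)
    simp only [HolL2.sub_apply] at h2
    refine h2.symm.le.trans ?_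
    gcongr
    rw [← ofReal_norm, ← dist_eq_norm]
    exact ENNReal.ofReal_le_ofReal (hN n hn m hm).le
  obtain ⟨N, hN⟩ := hfatou 1 one_pos
  obtain ⟨δ, hδ⟩ : ∃ δ : HolL2 l, ∀ Z ∈ cartanDomain, δ Z = u N Z - f Z :=
    ⟨HolL2.mk (fun Z => u N Z - f Z) (DifferentiableOn.fun_sub (u N).2.1 hd)
      ((hN N le_rfl).trans_lt (by simp)), fun Z hZ => HolL2.mk_apply _ _ _ hZ⟩
  refine ⟨u N - δ, ?_⟩
  have hval : ∀ Z ∈ cartanDomain, (u N - δ) Z = f Z := by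
    intro Z hZ
    rw [HolL2.sub_apply, hδ Z hZ]
    ring
  rw [Metric.tendsto_atTop]
  intro ε hε
  obtain ⟨M, hM⟩ := hfatou (ε / 2) (by positivity)
  refine ⟨M, fun n hn => ?_⟩
  have h1 : ‖u n - (u N - δ)‖ₑ ^ 2 ≤ ENNReal.ofReal (ε / 2) ^ 2 := by
    rw [HolL2.enorm_sq]
    refine le_trans (le_of_eq (lintegral_congr_ae ?_)) (hM n hn)
    filter_upwards [ae_mem_cartanDomain l] with Z hZ
    rw [HolL2.sub_apply, hval Z hZ]
  have h2 : ‖u n - (u N - δ)‖ₑ ≤ ENNReal.ofReal (ε / 2) :=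
    (ENNReal.pow_right_strictMono two_ne_zero).le_iff_le.1 h1
  rw [← ofReal_norm, ENNReal.ofReal_le_ofReal_iff (by positivity)] at h2
  rw [dist_eq_norm]
  linarith

end Bergman

section Representation

open MeasureTheory Filter Topology

/-! ### Strong continuity -/

theorem continuous_mat : Continuous mat := Units.continuous_val.comp continuous_subtype_val

theorem continuous_blockA : Continuous blockA := continuous_mat.matrix_submatrix Sum.inl Sum.inl

theorem continuous_blockB : Continuous blockB := continuous_mat.matrix_submatrix Sum.inl Sum.inr

theorem continuous_blockC : Continuous blockC := continuous_mat.matrix_submatrix Sum.inr Sum.inl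

theorem continuous_blockD : Continuous blockD := continuous_mat.matrix_submatrix Sum.inr Sum.inr

theorem continuous_denominator : Continuous fun p : U22 × Mat2 => denominator p.1 p.2 :=
  (continuous_blockD.comp continuous_fst).matrix_conjTranspose.sub
    ((continuous_blockB.comp continuous_fst).matrix_conjTranspose.matrix_mul continuous_snd)

/-- The diagonal matrix coefficient of the constant function `1`. -/
theorem inner_oneFun_rep_oneFun (l : ℕ) [Fact (4 ≤ l)] (g : U22) :
    inner ℂ (oneFun l) (rep l g (oneFun l)) = (denominator g 0).det ^ (-(l : ℤ)) := by
  rw [inner_oneFun, rep_apply _ _ _ zero_mem_cartanDomain,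
    oneFun_apply _ (invAction_mem g zero_mem_cartanDomain), mul_one]

theorem inner_rep_left (l : ℕ) [Fact (4 ≤ l)] (g : U22) (φ ψ : HolL2 l) :
    inner ℂ (rep l g φ) ψ = inner ℂ φ (rep l g⁻¹ ψ) := by
  rw [← (rep l g⁻¹).inner_map_map, map_inv]
  congr 1
  exact (rep l g).symm_apply_apply φ

theorem eq_zero_of_inner_rep_oneFun (l : ℕ) [Fact (4 ≤ l)] {φ : HolL2 l}
    (h : ∀ g, inner ℂ (rep l g (oneFun l)) φ = 0) : φ = 0 := by
  refine HolL2.ext fun Z hZ => ?_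
  obtain ⟨k, -, hk⟩ := exists_eval_eq l hZ
  have h1 := h k⁻¹
  rw [inner_rep_left, inv_inv] at h1
  rw [hk, h1, mul_zero]
  rfl

/-- The constant function `1` is a cyclic vector. -/
theorem eq_top_of_rep_oneFun_mem (l : ℕ) [Fact (4 ≤ l)] {W : Submodule ℂ (HolL2 l)}
    (hW : IsClosed (W : Set (HolL2 l))) (h : ∀ g, rep l g (oneFun l) ∈ W) : W = ⊤ := by
  have := completeSpace_holL2 l
  have : CompleteSpace W := hW.completeSpace_coe
  rw [← Submodule.orthogonal_eq_bot_iff, Submodule.eq_bot_iff]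
  exact fun φ hφ => eq_zero_of_inner_rep_oneFun l fun g =>
    (Submodule.mem_orthogonal _ _).1 hφ _ (h g)

/-- By unitarity `‖U(g)1 - U(g₀)1‖² = 2 - 2 Re ⟨1|U(g₀⁻¹g)1⟩`, which is continuous in `g`. -/
theorem continuous_rep_oneFun (l : ℕ) [Fact (4 ≤ l)] :
    Continuous fun g : U22 => rep l g (oneFun l) := by
  rw [continuous_iff_continuousAt]
  intro g₀
  have hcoef : Continuous fun g : U22 => (denominator g 0).det ^ (-(l : ℤ)) := by
    have h1 : Continuous fun g : U22 => (denominator g 0).det :=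
      (continuous_denominator.comp (continuous_id.prodMk continuous_const)).matrix_det
    exact h1.zpow₀ _ fun g => Or.inl (det_denominator_ne_zero g zero_mem_cartanDomain)
  have hnorm : ∀ g : U22, ‖rep l g (oneFun l) - rep l g₀ (oneFun l)‖ ^ 2 =
      2 - 2 * ((denominator (g₀⁻¹ * g) 0).det ^ (-(l : ℤ))).re := by
    intro g
    rw [← inner_oneFun_rep_oneFun, map_mul, LinearIsometryEquiv.coe_mul, Function.comp_apply,
      ← inner_rep_left, norm_sub_rev, norm_sub_sq (𝕜 := ℂ)]
    simp only [LinearIsometryEquiv.norm_map, norm_oneFun]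
    change 1 ^ 2 - 2 * (inner ℂ (rep l g₀ (oneFun l)) (rep l g (oneFun l))).re + 1 ^ 2 = _
    ring
  rw [ContinuousAt, tendsto_iff_norm_sub_tendsto_zero]
  have hlim : Tendsto (fun g : U22 => √(2 - 2 *
      ((denominator (g₀⁻¹ * g) 0).det ^ (-(l : ℤ))).re)) (𝓝 g₀) (𝓝 0) := by
    have hc : Continuous fun g : U22 => √(2 - 2 *
        ((denominator (g₀⁻¹ * g) 0).det ^ (-(l : ℤ))).re) :=
      Real.continuous_sqrt.comp (continuous_const.sub (continuous_const.mul
        (Complex.continuous_re.comp (hcoef.comp (continuous_const.mul continuous_id)))))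
    have := hc.tendsto g₀
    simpa using this
  refine hlim.congr fun g => ?_
  rw [← hnorm, Real.sqrt_sq (norm_nonneg _)]

/-- The vectors with continuous orbit form a closed subspace, and it contains the orbit of the
cyclic vector `1`. -/
theorem isStronglyContinuous_rep (l : ℕ) [Fact (4 ≤ l)] : IsStronglyContinuous (rep l) := by
  let V : Submodule ℂ (HolL2 l) :=
    { carrier := {φ | Continuous fun g : U22 => rep l g φ}
      zero_mem' := by simpa using continuous_const
      add_mem' := fun {φ ψ} hφ hψ => (Continuous.add hφ hψ).congr fun g => (map_add _ φ ψ).symm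
      smul_mem' := fun c φ hφ => (Continuous.const_smul hφ c).congr fun g =>
        (map_smul (rep l g) c φ).symm }
  have hV : IsClosed (V : Set (HolL2 l)) := by
    refine isClosed_of_closure_subset fun φ hφ => ?_
    refine continuous_of_uniform_approx_of_continuous fun s hs => ?_
    obtain ⟨ε, hε, hεs⟩ := Metric.mem_uniformity_dist.1 hs
    obtain ⟨ψ, hψ, hd⟩ := Metric.mem_closure_iff.1 hφ ε hε
    exact ⟨fun g => rep l g ψ, hψ, fun g => hεs (by
      rw [LinearIsometryEquiv.dist_map]; exact hd)⟩
  have hmem : ∀ h, rep l h (oneFun l) ∈ V := by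
    intro h
    change Continuous fun g : U22 => rep l g (rep l h (oneFun l))
    have : (fun g : U22 => rep l g (rep l h (oneFun l))) = fun g => rep l (g * h) (oneFun l) := by
      funext g
      rw [map_mul]
      rfl
    rw [this]
    exact (continuous_rep_oneFun l).comp (continuous_id.mul continuous_const)
  have htop := eq_top_of_rep_oneFun_mem l hV hmem
  intro φ
  have : φ ∈ V := htop ▸ Submodule.mem_top
  exact this

/-! ### Irreducibility -/

theorem HolL2.eq_smul_oneFun_of_rotation_invariant {l : ℕ} [Fact (4 ≤ l)] {φ : HolL2 l}
    (h : ∀ θ, rep l (rotation θ) φ = φ) : φ = φ 0 • oneFun l := by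
  refine HolL2.ext fun Z hZ => ?_
  have h1 : ∀ θ : ℝ, φ (Complex.exp (θ * Complex.I) • Z) = φ Z := fun θ => by
    rw [← rep_rotation_apply l θ φ hZ, h θ]
  have h2 := mean_value φ hZ
  simp only [h1, intervalIntegral.integral_const, sub_zero] at h2
  rw [inv_smul_smul₀ (by positivity)] at h2
  rw [HolL2.smul_apply, oneFun_apply l hZ, mul_one, h2]

/-- The projection of `1` to a closed invariant subspace is a constant, which is `0` or forces the
subspace to contain `1`. -/
theorem isIrreducible_rep (l : ℕ) [Fact (4 ≤ l)] : IsIrreducible (rep l) := by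
  have hcs := completeSpace_holL2 l
  have hne : oneFun l ≠ 0 := by
    rw [← norm_ne_zero_iff, norm_oneFun]
    exact one_ne_zero
  refine ⟨⟨oneFun l, 0, hne⟩, fun W hW hinv => ?_⟩
  have : CompleteSpace W := hW.completeSpace_coe
  have hinv' : ∀ g, ∀ φ ∈ Wᗮ, rep l g φ ∈ Wᗮ := by
    intro g φ hφ
    rw [Submodule.mem_orthogonal'] at hφ ⊢
    intro w hw
    rw [inner_rep_left]
    exact hφ _ (hinv _ _ hw)
  set p := W.starProjection (oneFun l) with hp
  have hpW : p ∈ W := Submodule.starProjection_apply_mem _ _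
  have hq : oneFun l - p ∈ Wᗮ := Submodule.sub_starProjection_mem_orthogonal _
  -- the projection of a rotation invariant vector is rotation invariant
  have hrot : ∀ θ, rep l (rotation θ) p = p := by
    intro θ
    refine (Submodule.eq_starProjection_of_mem_orthogonal (hinv _ _ hpW) ?_).symm
    have h1 := hinv' (rotation θ) _ hq
    rwa [map_sub, rep_rotation_oneFun] at h1
  have hconst := HolL2.eq_smul_oneFun_of_rotation_invariant hrot
  by_cases h0 : p 0 = 0
  · left
    rw [h0, zero_smul] at hconst
    rw [hconst, sub_zero] at hq
    rw [Submodule.eq_bot_iff]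
    exact fun w hw => eq_zero_of_inner_rep_oneFun l fun g =>
      (Submodule.mem_orthogonal' _ _).1 (hinv' g _ hq) w hw
  · right
    refine eq_top_of_rep_oneFun_mem l hW fun g => hinv g _ ?_
    have : oneFun l = (p 0)⁻¹ • p := (inv_smul_eq_iff₀ h0).2 hconst |>.symm
    rw [this]
    exact W.smul_mem _ hpW

end Representation

section SquareIntegrable

open MeasureTheory Filter Topology

/-! ### Compactness in `U(2,2)` -/

/-- The squared Frobenius norm. -/
def frobSq (M : Mat2) : ℝ := ∑ i, ∑ j, ‖M i j‖ ^ 2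

theorem trace_conjTranspose_mul_self (M : Mat2) : (Mᴴ * M).trace = frobSq M := by
  simp only [Matrix.trace_fin_two, Matrix.mul_apply, Fin.sum_univ_two, Matrix.conjTranspose_apply,
    Complex.star_def, Complex.conj_mul', frobSq]
  push_cast
  ring

theorem frobSq_conjTranspose (M : Mat2) : frobSq Mᴴ = frobSq M := by
  simp only [frobSq, Fin.sum_univ_two, Matrix.conjTranspose_apply, norm_star]
  ring

theorem frobSq_nonneg (M : Mat2) : 0 ≤ frobSq M :=
  Finset.sum_nonneg fun _ _ => Finset.sum_nonneg fun _ _ => sq_nonneg _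

theorem norm_apply_sq_le_frobSq (M : Mat2) (i j : Fin 2) : ‖M i j‖ ^ 2 ≤ frobSq M :=
  (Finset.single_le_sum (f := fun j => ‖M i j‖ ^ 2) (fun _ _ => sq_nonneg _)
    (Finset.mem_univ j)).trans
    (Finset.single_le_sum (f := fun i => ∑ j, ‖M i j‖ ^ 2)
      (fun _ _ => Finset.sum_nonneg fun _ _ => sq_nonneg _) (Finset.mem_univ i))

theorem blocks_form (g : U22) : (blockA g)ᴴ * blockA g = 1 + (blockC g)ᴴ * blockC g ∧
    (blockD g)ᴴ * blockD g = 1 + (blockB g)ᴴ * blockB g := by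
  have h := mat_form g
  rw [mat_eq_fromBlocks, gamma5, Matrix.fromBlocks_conjTranspose, Matrix.fromBlocks_multiply,
    Matrix.fromBlocks_multiply, Matrix.fromBlocks_inj] at h
  obtain ⟨h1, -, -, h4⟩ := h
  simp only [mul_neg, mul_one, mul_zero, add_zero, zero_add, neg_mul] at h1 h4
  constructor
  · rw [← sub_eq_zero, ← neg_eq_zero, ← sub_eq_zero.2 h1]
    abel
  · rw [← h4]
    abel

theorem blockB_inv (g : U22) : blockB g⁻¹ = -(blockC g)ᴴ := by
  have h := mat_eq_fromBlocks g⁻¹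
  rw [mat_inv_eq_fromBlocks, Matrix.fromBlocks_inj] at h
  exact h.2.1.symm

theorem blockD_inv (g : U22) : blockD g⁻¹ = (blockD g)ᴴ := by
  have h := mat_eq_fromBlocks g⁻¹
  rw [mat_inv_eq_fromBlocks, Matrix.fromBlocks_inj] at h
  exact h.2.2.2.symm

theorem frobSq_blockD (g : U22) : frobSq (blockD g) = 2 + frobSq (blockB g) := by
  have h := congrArg Matrix.trace (blocks_form g).2
  rw [Matrix.trace_add, trace_conjTranspose_mul_self, trace_conjTranspose_mul_self,
    Matrix.trace_one, Fintype.card_fin] at h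
  exact_mod_cast h

theorem frobSq_blockA (g : U22) : frobSq (blockA g) = 2 + frobSq (blockC g) := by
  have h := congrArg Matrix.trace (blocks_form g).1
  rw [Matrix.trace_add, trace_conjTranspose_mul_self, trace_conjTranspose_mul_self,
    Matrix.trace_one, Fintype.card_fin] at h
  exact_mod_cast h

theorem frobSq_blockC (g : U22) : frobSq (blockC g) = frobSq (blockB g) := by
  have h := frobSq_blockD g⁻¹
  have hneg : frobSq (-(blockC g)ᴴ) = frobSq (blockC g)ᴴ := by simp [frobSq]
  rw [blockB_inv, blockD_inv, hneg, frobSq_conjTranspose, frobSq_conjTranspose,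
    frobSq_blockD] at h
  linarith

/-- `|det D|² = det(I + B†B)`, expanded for `2 × 2` matrices. -/
theorem norm_det_blockD_sq (g : U22) :
    ‖(blockD g).det‖ ^ 2 = 1 + frobSq (blockB g) + ‖(blockB g).det‖ ^ 2 := by
  have hdet : ∀ X : Mat2, (1 + X).det = 1 + X.trace + X.det := by
    intro X
    simp [Matrix.det_fin_two, Matrix.trace_fin_two]
    ring
  have h := congrArg Matrix.det (blocks_form g).2
  rw [hdet, trace_conjTranspose_mul_self, Matrix.det_mul, Matrix.det_mul, Matrix.det_conjTranspose,
    Matrix.det_conjTranspose, Complex.star_def, Complex.conj_mul', Complex.conj_mul'] at h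
  exact_mod_cast h

section Embedding

attribute [local instance] Matrix.linftyOpNormedRing Matrix.linftyOpNormedAlgebra

theorem isEmbedding_mat : IsEmbedding mat :=
  (Units.isOpenEmbedding_val
    (R := Matrix (Fin 2 ⊕ Fin 2) (Fin 2 ⊕ Fin 2) ℂ)).isEmbedding.comp IsEmbedding.subtypeVal

end Embedding

theorem isClosedEmbedding_mat : IsClosedEmbedding mat := by
  refine ⟨isEmbedding_mat, ?_⟩
  have : Set.range mat = {M | Mᴴ * gamma5 * M = gamma5} :=
    Set.Subset.antisymm (Set.range_subset_iff.2 mat_form) fun M hM => ⟨ofForm M hM, rfl⟩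
  rw [this]
  exact isClosed_eq ((continuous_id.matrix_conjTranspose.matrix_mul
    continuous_const).matrix_mul continuous_id) continuous_const

instance : SecondCountableTopology U22 :=
  have : SecondCountableTopology (Matrix (Fin 2 ⊕ Fin 2) (Fin 2 ⊕ Fin 2) ℂ) :=
    inferInstanceAs (SecondCountableTopology (Fin 2 ⊕ Fin 2 → Fin 2 ⊕ Fin 2 → ℂ))
  isClosedEmbedding_mat.isEmbedding.secondCountableTopology

/-- A bound on `|det D|` bounds all entries of `g`, since the Frobenius norms of the blocks are at
most `1 + |det D|²`. -/
theorem exists_isCompact_of_norm_det_le (R : ℝ) :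
    ∃ K : Set U22, IsCompact K ∧ {g : U22 | ‖(blockD g).det‖ ^ 2 ≤ R} ⊆ K := by
  let K : Set (Matrix (Fin 2 ⊕ Fin 2) (Fin 2 ⊕ Fin 2) ℂ) :=
    Set.univ.pi fun _ => Set.univ.pi fun _ => Metric.closedBall (0 : ℂ) √(R + 1)
  have hK : IsCompact K := isCompact_univ_pi fun _ => isCompact_univ_pi fun _ =>
    isCompact_closedBall _ _
  refine ⟨mat ⁻¹' K, isClosedEmbedding_mat.isCompact_preimage hK, fun g hg => ?_⟩
  have hB : frobSq (blockB g) ≤ R - 1 := by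
    have h1 := norm_det_blockD_sq g
    have h2 : ‖(blockD g).det‖ ^ 2 ≤ R := hg
    nlinarith [sq_nonneg ‖(blockB g).det‖]
  have hall : ∀ M : Mat2, frobSq M ≤ R + 1 → ∀ i j, M i j ∈ Metric.closedBall (0 : ℂ) √(R + 1) := by
    intro M hM i j
    rw [mem_closedBall_zero_iff]
    exact Real.le_sqrt_of_sq_le ((norm_apply_sq_le_frobSq M i j).trans hM)
  have hA := hall (blockA g) (by rw [frobSq_blockA, frobSq_blockC]; linarith)
  have hB' := hall (blockB g) (by linarith)
  have hC := hall (blockC g) (by rw [frobSq_blockC]; linarith)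
  have hD := hall (blockD g) (by rw [frobSq_blockD]; linarith)
  intro i _ j _
  rcases i with i | i <;> rcases j with j | j
  exacts [hA i j, hB' i j, hC i j, hD i j]

/-! ### Square integrability -/

/-- Haar measure is right invariant under Hermitian elements: such an `h` is conjugate to `h⁻¹` by
`γ⁵`, so the modular character takes a value `Δ(h)` with `Δ(h)² = 1`. -/
theorem map_mul_right_haar {h : U22} (hh : (mat h).IsHermitian) :
    Measure.map (· * h) (Measure.haar : Measure U22) = Measure.haar := by
  have h1 : Measure.modularCharacter (h⁻¹) = Measure.modularCharacter h := by
    rw [← gammaElt_conj hh, map_mul, map_mul, mul_right_comm, ← map_mul, mul_inv_cancel, map_one,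
      one_mul]
  have h2 : Measure.modularCharacter h * Measure.modularCharacter h = 1 := by
    nth_rewrite 1 [← h1]
    rw [← map_mul, inv_mul_cancel, map_one]
  have h3 : Measure.modularCharacterFun h = 1 := by
    change Measure.modularCharacterFun h * Measure.modularCharacterFun h = 1 at h2
    rw [← sq] at h2
    exact (pow_eq_one_iff_of_nonneg zero_le two_ne_zero).1 h2
  rw [Measure.map_right_mul_eq_modularCharacterFun_smul, h3, one_smul]

theorem lintegral_mul_right_haar {h : U22} (hh : (mat h).IsHermitian) {f : U22 → ENNReal}
    (hf : Measurable f) : ∫⁻ g, f (g * h) ∂Measure.haar = ∫⁻ g, f g ∂Measure.haar := by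
  conv_rhs => rw [← map_mul_right_haar hh]
  rw [lintegral_map hf (measurable_mul_const h)]

/-- The squared modulus of the automorphy factor, which is also that of the function `U(g)1`. -/
def weight (l : ℕ) (g : U22) (Z : Mat2) : ENNReal := ‖(denominator g Z).det ^ (-(l : ℤ))‖ₑ ^ 2

theorem measurable_weight (l : ℕ) : Measurable fun p : U22 × Mat2 => weight l p.1 p.2 :=
  ((continuous_denominator.matrix_det.measurable.pow_const _).enorm).pow_const 2

theorem measurable_invAction : Measurable fun p : U22 × Mat2 => invAction p.1 p.2 := by
  have h1 : Continuous fun p : U22 × Mat2 => ((blockA p.1)ᴴ * p.2 - (blockC p.1)ᴴ) *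
      (denominator p.1 p.2).adjugate :=
    (((continuous_blockA.comp continuous_fst).matrix_conjTranspose.matrix_mul continuous_snd).sub
      (continuous_blockC.comp continuous_fst).matrix_conjTranspose).matrix_mul
      continuous_denominator.matrix_adjugate
  have h2 : (fun p : U22 × Mat2 => invAction p.1 p.2) = fun p : U22 × Mat2 =>
      ((denominator p.1 p.2).det)⁻¹ • (((blockA p.1)ᴴ * p.2 - (blockC p.1)ᴴ) *
      (denominator p.1 p.2).adjugate) := by
    funext p
    rw [invAction, Matrix.inv_def, Ring.inverse_eq_inv', Matrix.mul_smul]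
  rw [h2]
  exact Measurable.fun_smul continuous_denominator.matrix_det.measurable.inv h1.measurable

theorem detOne_invAction_zero (g : U22) :
    detOne (invAction g 0) * ‖(blockD g).det‖ ^ 2 = 1 := by
  have h := detOne_invAction g zero_mem_cartanDomain
  rwa [denominator_zero, Matrix.det_conjTranspose, norm_star, detOne_zero] at h

/-- By left invariance `∫ |U(g)1(Z)|² dg` is a multiple of its value at `Z = 0`, with factor
`|det D|^{2l} ≥ 1` for an element that moves `0` to `Z`. -/
theorem lintegral_weight_zero_le (l : ℕ) {Z : Mat2} (hZ : Z ∈ cartanDomain) :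
    ∫⁻ g, weight l g 0 ∂Measure.haar ≤ ∫⁻ g, weight l g Z ∂Measure.haar := by
  obtain ⟨h, -, hh⟩ := exists_hermitian_boost hZ
  rw [← lintegral_mul_left_eq_self (fun g => weight l g 0) h⁻¹]
  refine lintegral_mono fun g => ?_
  have h1 : 1 ≤ ‖(denominator h⁻¹ 0).det‖ := by
    rw [denominator_zero, Matrix.det_conjTranspose, norm_star]
    have := norm_det_blockD_sq h⁻¹
    have := frobSq_nonneg (blockB h⁻¹)
    rw [← one_le_sq_iff₀ (norm_nonneg _)]
    nlinarith [sq_nonneg ‖(blockB h⁻¹).det‖]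
  have h2 : ‖(denominator h⁻¹ 0).det ^ (-(l : ℤ))‖ₑ ≤ 1 := by
    rw [← ofReal_norm, ← ENNReal.ofReal_one, norm_zpow, zpow_neg, zpow_natCast]
    exact ENNReal.ofReal_le_ofReal (inv_le_one_of_one_le₀ (one_le_pow₀ h1))
  simp only [weight]
  rw [denominator_mul h⁻¹ g zero_mem_cartanDomain, hh, Matrix.det_mul, mul_zpow, enorm_mul, mul_pow]
  exact mul_le_of_le_one_right' (pow_le_one₀ zero_le h2)

/-- An open neighbourhood of `0` in the domain, with relatively compact preimage in `U(2,2)`. -/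
def innerRegion : Set Mat2 := {Z ∈ cartanDomain | 1 / 2 < detOne Z}

theorem isOpen_innerRegion : IsOpen innerRegion :=
  isOpen_cartanDomain.inter (isOpen_lt continuous_const (Complex.continuous_re.comp
    (continuous_const.sub
      (continuous_id.matrix_mul continuous_id.matrix_conjTranspose)).matrix_det))

theorem bergmanMeasure_innerRegion_ne_zero (l : ℕ) [hl : Fact (4 ≤ l)] :
    bergmanMeasure l innerRegion ≠ 0 := by
  rw [bergmanMeasure, Ne, withDensity_apply_eq_zero (measurable_density l).ennreal_ofReal]
  have h1 : innerRegion ⊆ {Z | ENNReal.ofReal (density l Z) ≠ 0} ∩ innerRegion := fun Z hZ =>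
    ⟨(ENNReal.ofReal_pos.2 (density_pos l hl.out hZ.1)).ne', hZ⟩
  intro h0
  have h2 := measure_mono_null h1 h0
  rw [Measure.restrict_apply isOpen_innerRegion.measurableSet,
    Set.inter_eq_left.2 fun Z hZ => hZ.1] at h2
  exact (isOpen_innerRegion.measure_pos volume
    ⟨0, zero_mem_cartanDomain, by rw [detOne_zero]; norm_num⟩).ne' h2

theorem haar_orbit_lt_top :
    (Measure.haar : Measure U22) {g | invAction g⁻¹ 0 ∈ innerRegion} < ⊤ := by
  obtain ⟨K, hK, hsub⟩ := exists_isCompact_of_norm_det_le 2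
  refine (measure_mono fun g hg => hsub ?_).trans_lt hK.measure_lt_top
  have h1 := detOne_invAction_zero g⁻¹
  rw [blockD_inv, Matrix.det_conjTranspose, norm_star] at h1
  have h2 : 1 / 2 < detOne (invAction g⁻¹ 0) := hg.2
  change ‖(blockD g).det‖ ^ 2 ≤ 2
  nlinarith [sq_nonneg ‖(blockD g).det‖]

/-- The indicator function of `{(g, W) : gW ∈ innerRegion}`. -/
def orbitIndicator (g : U22) (W : Mat2) : ENNReal := innerRegion.indicator 1 (invAction g⁻¹ W)

theorem measurable_inv_invAction :
    Measurable fun p : U22 × Mat2 => invAction p.1⁻¹ p.2 := by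
  have h1 : Measurable fun p : U22 × Mat2 => ((p.1⁻¹, p.2) : U22 × Mat2) :=
    (continuous_fst.inv.prodMk continuous_snd).measurable
  have h2 := measurable_invAction.comp h1
  exact h2

theorem measurable_orbitIndicator : Measurable fun p : U22 × Mat2 => orbitIndicator p.1 p.2 := by
  have h1 : Measurable (innerRegion.indicator (1 : Mat2 → ENNReal)) :=
    measurable_one.indicator isOpen_innerRegion.measurableSet
  exact h1.comp measurable_inv_invAction

theorem setLIntegral_weight (l : ℕ) (g : U22) :
    ∫⁻ Z in innerRegion, weight l g Z ∂(bergmanMeasure l) =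
      ∫⁻ W, orbitIndicator g W ∂(bergmanMeasure l) := by
  rw [← lintegral_invAction l g fun W => orbitIndicator g W,
    ← lintegral_indicator isOpen_innerRegion.measurableSet]
  refine lintegral_congr_ae ?_
  filter_upwards [ae_mem_cartanDomain l] with Z hZ
  rw [orbitIndicator, invAction_inv_invAction g hZ]
  by_cases h : Z ∈ innerRegion <;> simp [h, weight]

theorem lintegral_orbitIndicator {W : Mat2} (hW : W ∈ cartanDomain) :
    ∫⁻ g, orbitIndicator g W ∂(Measure.haar : Measure U22) =
      (Measure.haar : Measure U22) {g | invAction g⁻¹ 0 ∈ innerRegion} := by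
  obtain ⟨h, hherm, hh⟩ := exists_hermitian_boost hW
  have hpair : Measurable fun g : U22 => ((g, 0) : U22 × Mat2) :=
    measurable_id.prodMk measurable_const
  have h0 := measurable_orbitIndicator.comp hpair
  have hinv := measurable_inv_invAction.comp hpair
  have hset : MeasurableSet {g : U22 | invAction g⁻¹ 0 ∈ innerRegion} :=
    hinv isOpen_innerRegion.measurableSet
  rw [← lintegral_indicator_one hset, ← hh]
  refine Eq.trans ?_ (lintegral_mul_right_haar hherm h0)
  refine lintegral_congr fun g => ?_
  change orbitIndicator g (invAction h⁻¹ 0) = orbitIndicator (g * h) 0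
  rw [orbitIndicator, orbitIndicator, mul_inv_rev, invAction_mul h⁻¹ g⁻¹ zero_mem_cartanDomain]

/-- The diagonal coefficient of `1` is square integrable. Integrating `|U(g)1(Z)|²` over `Z` in a
neighbourhood `S` of `0` and over `g`, the change of variables `W = g⁻¹Z` gives the measure of
`{(g, W) : gW ∈ S}`, and by unimodularity the measure of `{g : gW ∈ S}` does not depend on `W`. -/
theorem lintegral_weight_lt_top (l : ℕ) [Fact (4 ≤ l)] :
    ∫⁻ g, weight l g 0 ∂(Measure.haar : Measure U22) < ⊤ := by
  have hS := isOpen_innerRegion.measurableSet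
  have hswap := lintegral_lintegral_swap (μ := (bergmanMeasure l).restrict innerRegion)
    (ν := (Measure.haar : Measure U22)) (f := fun Z g => weight l g Z)
    ((measurable_weight l).comp measurable_swap).aemeasurable
  have hswap' := lintegral_lintegral_swap (μ := (Measure.haar : Measure U22))
    (ν := bergmanMeasure l) (f := orbitIndicator) measurable_orbitIndicator.aemeasurable
  simp only [setLIntegral_weight] at hswap
  have hconst : ∫⁻ W, ∫⁻ g, orbitIndicator g W ∂(Measure.haar : Measure U22) ∂(bergmanMeasure l) =
      ∫⁻ _, (Measure.haar : Measure U22) {g | invAction g⁻¹ 0 ∈ innerRegion} ∂(bergmanMeasure l) :=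
    lintegral_congr_ae (by
      filter_upwards [ae_mem_cartanDomain l] with W hW using lintegral_orbitIndicator hW)
  rw [hswap', hconst, lintegral_const, measure_univ, mul_one] at hswap
  have hle : (∫⁻ g, weight l g 0 ∂(Measure.haar : Measure U22)) * bergmanMeasure l innerRegion ≤
      (Measure.haar : Measure U22) {g | invAction g⁻¹ 0 ∈ innerRegion} := by
    rw [← hswap, ← setLIntegral_const]
    exact setLIntegral_mono' hS fun Z hZ => lintegral_weight_zero_le l hZ.1
  -- the region has positive measure, so an infinite integral would contradict `hle`
  by_contra htop
  rw [not_lt, top_le_iff] at htop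
  rw [htop, ENNReal.top_mul (bergmanMeasure_innerRegion_ne_zero l), top_le_iff] at hle
  exact haar_orbit_lt_top.ne hle

theorem isSquareIntegrable_rep (l : ℕ) [Fact (4 ≤ l)] : IsSquareIntegrable (rep l) := by
  refine ⟨oneFun l, ?_, ?_⟩
  · rw [← norm_ne_zero_iff, norm_oneFun]
    exact one_ne_zero
  · refine lt_of_le_of_lt (le_of_eq (lintegral_congr fun g => ?_)) (lintegral_weight_lt_top l)
    rw [weight, ← inner_oneFun_rep_oneFun, ← inner_conj_symm, RCLike.enorm_conj]

end SquareIntegrable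

end Conformal

end

theorem mainTheorem3 (l : ℕ) [Fact (4 ≤ l)] :
    -- the action is well defined: `D† - B† Z` is invertible and `g⁻¹ Z` stays in the domain
    (∀ g : Conformal.U22, ∀ Z ∈ Conformal.cartanDomain,
      IsUnit (Conformal.denominator g Z) ∧
        Conformal.invAction g Z ∈ Conformal.cartanDomain) ∧
    -- the representation space is a Hilbert space
    CompleteSpace (Conformal.HolL2 l) ∧
    -- the constant function `1` belongs to it and has norm one
    (∃ e : Conformal.HolL2 l, (∀ Z ∈ Conformal.cartanDomain, e Z = 1) ∧ ‖e‖ = 1) ∧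
    -- the formula defines a unitary, irreducible, square integrable representation
    ∃ U : Conformal.U22 →* (Conformal.HolL2 l ≃ₗᵢ[ℂ] Conformal.HolL2 l),
      (∀ (g : Conformal.U22) (φ : Conformal.HolL2 l), ∀ Z ∈ Conformal.cartanDomain,
        U g φ Z = (Conformal.denominator g Z).det ^ (-(l : ℤ)) *
          φ (Conformal.invAction g Z)) ∧
      Conformal.IsStronglyContinuous U ∧
      Conformal.IsIrreducible U ∧
      Conformal.IsSquareIntegrable U :=
  ⟨fun g _ hZ => ⟨Conformal.isUnit_denominator g hZ, Conformal.invAction_mem g hZ⟩,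
    Conformal.completeSpace_holL2 l,
    ⟨Conformal.oneFun l, fun _ hZ => Conformal.oneFun_apply l hZ, Conformal.norm_oneFun l⟩,
    Conformal.rep l, fun g φ _ hZ => Conformal.rep_apply l g φ hZ,
    Conformal.isStronglyContinuous_rep l, Conformal.isIrreducible_rep l,
    Conformal.isSquareIntegrable_rep l⟩
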